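/- Let $\mathfrak g$ be a finite-dimensional complex simple Lie algebra with Cartan subalgebra $\mathfrak h$, root system $\Phi$, simple roots $\{\alpha_i\}_{i\in I}$ with simple coroots $h_i\in\mathfrak h$, and $\mathfrak n^+=\bigoplus_{\alpha\in\Phi^+}\mathfrak g_\alpha$. Let $\omega_i\in\mathfrak h^*$ ($i\in I$) be the fundamental weights, $\omega_i(h_j)=\delta_{ij}$, let $P^+=\sum_{i}\mathbb Z_{\ge0}\,\omega_i$, and for $i\in I$ let $x^-_{\alpha_i}\in\mathfrak g_{-\alpha_i}$ be a nonzero root vector. For a commutative associative unital $\mathbb C$-algebra $A$, let $\mathfrak g\otimes A$ have the bracket $[x\otimes a,y\otimes b]=[x,y]\otimes ab$. For $\lambda\in P^+$ the global Weyl module $W_A(\lambda)$ is the left $U(\mathfrak g\otimes A)$-module generated by an element $w_\lambda$ with defining relations $$(\mathfrak n^+\otimes A)w_\lambda=0,\qquad (h\otimes 1)w_\lambda=\lambda(h)w_\lambda\ (h\in\mathfrak h),\qquad (x^-_{\alpha_i}\otimes 1)^{\lambda(h_i)+1}w_\lambda=0\ (i\in I).$$ Let $\mathbf A_\lambda=U(\mathfrak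 h\otimes A)/\mathrm{Ann}_{U(\mathfrak h\otimes A)}(w_\lambda)$, a commutative algebra, which acts on $W_A(\lambda)$ on the right by $(uw_\lambda)p=u\,p\,w_\lambda$ for $u\in U(\mathfrak g\otimes A)$ and $p\in U(\mathfrak h\otimes A)$. For $\mathbf s=(s_i)_{i\in I}\in\mathbb Z_{\ge0}^I$ put $$\mathbf A_{\mathbf s}=\bigotimes_{i\in I}\mathbf A_{\omega_i}^{\otimes s_i},\qquad W_A(\mathbf s)=\bigotimes_{i\in I}W_A(\omega_i)^{\otimes s_i},$$ all tensor products being over $\mathbb C$; $\mathfrak g\otimes A$ acts on $W_A(\mathbf s)$ by the Leibniz rule, and $\mathbf A_{\mathbf s}$ acts factorwise. For a $\mathfrak g\otimes A$-module $V$ and $\mu\in\mathfrak h^*$, let $V^{\mathfrak n^+\otimes A}=\{v\in V:(\mathfrak n^+\otimes A)v=0\}$, let $V_\mu=\{v\in V:(h\otimes1)v=\mu(h)v\ \text{for all }h\in\mathfrak h\}$, and let $V^{\mathfrak n^+\otimes A}_\mu=V^{\mathfrak n^+\otimes A}\cap V_\mu$. **Theorem.** Let $A=\mathbb C[t_1^{\pm1},\dots,t_k^{\pm1},u_1,\dots,u_\ell]$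 with $k,\ell\in\mathbb Z_{\ge0}$, let $\mathbf s\in\mathbb Z_{\ge0}^I$ and $\mu\in P^+$. Then there is an isomorphism of $\mathbf A_{\mathbf s}$-modules $$\mathrm{Hom}_{\mathfrak g\otimes A}(W_A(\mu),W_A(\mathbf s))\;\cong\;W_A(\mathbf s)^{\mathfrak n^+\otimes A}_\mu .$$ If moreover $k+\ell\ge1$ (that is, $A\ne\mathbb C$), then, as subspaces of $W_A(\mathbf s)$, $$W_A(\mathbf s)^{\mathfrak n^+\otimes A}_\mu=\Big(\bigotimes_{i\in I}\big(W_A(\omega_i)^{\mathfrak n^+\otimes A}\big)^{\otimes s_i}\Big)_\mu .$$ -/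

import Mathlib

open scoped TensorProduct

noncomputable section

namespace WeylHom

section Pi

variable {L ι : Type*} [LieRing L] [LieAlgebra ℂ L] [Fintype ι]
  {M : ι → Type*} [∀ i, AddCommGroup (M i)] [∀ i, Module ℂ (M i)]
  [∀ i, LieRingModule L (M i)] [∀ i, LieModule ℂ L (M i)]

open Classical in
/-- The action of `x` on a finite tensor product: `x` acts by the Leibniz rule, i.e. as
`∑ j, 1 ⊗ ⋯ ⊗ 1 ⊗ x ⊗ 1 ⊗ ⋯ ⊗ 1`. -/
def tensorAct (x : L) : Module.End ℂ (⨂[ℂ] i, M i) :=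
  ∑ j, PiTensorProduct.map
    (Function.update (fun i => (LinearMap.id : M i →ₗ[ℂ] M i)) j (LieModule.toEnd ℂ L (M j) x))

open Classical in
theorem tensorAct_tprod (x : L) (m : ∀ i, M i) :
    tensorAct x (PiTensorProduct.tprod ℂ m) =
      ∑ j, PiTensorProduct.tprod ℂ (Function.update m j ⁅x, m j⁆) := by
  rw [tensorAct, LinearMap.sum_apply]
  refine Finset.sum_congr rfl fun j _ => ?_
  rw [PiTensorProduct.map_tprod]
  congr 1
  funext i
  by_cases h : i = j
  · subst h; simp
  · simp [h]

theorem tensorAct_add (x y : L) :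
    (tensorAct (x + y) : Module.End ℂ (⨂[ℂ] i, M i)) = tensorAct x + tensorAct y := by
  simp only [tensorAct, map_add, PiTensorProduct.map_update_add, Finset.sum_add_distrib]

theorem tensorAct_smul (c : ℂ) (x : L) :
    (tensorAct (c • x) : Module.End ℂ (⨂[ℂ] i, M i)) = c • tensorAct x := by
  simp only [tensorAct, map_smul, PiTensorProduct.map_update_smul, Finset.smul_sum]

theorem tensorAct_lie (x y : L) :
    (tensorAct ⁅x, y⁆ : Module.End ℂ (⨂[ℂ] i, M i)) =
      tensorAct x * tensorAct y - tensorAct y * tensorAct x := by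
  classical
  apply PiTensorProduct.ext
  ext m
  simp only [LinearMap.compMultilinearMap_apply, LinearMap.sub_apply, Module.End.mul_apply,
    tensorAct_tprod, map_sum]
  have key : ∀ (x y : L), ∑ j, ∑ l, PiTensorProduct.tprod ℂ
      (Function.update (Function.update m j ⁅y, m j⁆) l ⁅x, Function.update m j ⁅y, m j⁆ l⁆) =
      ∑ j, PiTensorProduct.tprod ℂ (Function.update m j ⁅x, ⁅y, m j⁆⁆) +
      ∑ j, ∑ l ∈ Finset.univ.erase j, PiTensorProduct.tprod ℂ
      (Function.update (Function.update m j ⁅y, m j⁆) l ⁅x, m l⁆) := by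
    intro x y
    rw [← Finset.sum_add_distrib]
    refine Finset.sum_congr rfl fun j _ => ?_
    rw [← Finset.add_sum_erase _ _ (Finset.mem_univ j)]
    congr 1
    · simp
    · refine Finset.sum_congr rfl fun l hl => ?_
      rw [Function.update_of_ne (Finset.ne_of_mem_erase hl)]
  rw [key, key]
  have sw : ∑ j, ∑ l ∈ Finset.univ.erase j, PiTensorProduct.tprod ℂ
      (Function.update (Function.update m j ⁅y, m j⁆) l ⁅x, m l⁆) =
      ∑ j, ∑ l ∈ Finset.univ.erase j, PiTensorProduct.tprod ℂ
      (Function.update (Function.update m j ⁅x, m j⁆) l ⁅y, m l⁆) := by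
    rw [Finset.sum_comm' (t' := Finset.univ) (s' := fun j => Finset.univ.erase j)
      (by intro a c; simp [eq_comm])]
    refine Finset.sum_congr rfl fun l _ => Finset.sum_congr rfl fun j hj => ?_
    rw [Function.update_comm (Finset.ne_of_mem_erase hj)]
  rw [sw, add_sub_add_right_eq_sub, ← Finset.sum_sub_distrib]
  refine Finset.sum_congr rfl fun j _ => ?_
  rw [← MultilinearMap.map_update_sub, ← lie_lie]

/-- The tensor product of finitely many Lie modules is a Lie module. -/
instance piLieRingModule : LieRingModule L (⨂[ℂ] i, M i) where
  bracket x t := tensorAct x t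
  add_lie x y t := by simp [tensorAct_add]
  lie_add x t u := by simp
  leibniz_lie x y t := by simp [tensorAct_lie]

theorem lie_def (x : L) (t : ⨂[ℂ] i, M i) : ⁅x, t⁆ = tensorAct x t := rfl

instance piLieModule : LieModule ℂ L (⨂[ℂ] i, M i) where
  smul_lie c x t := by simp [lie_def, tensorAct_smul]
  lie_smul c x t := by simp [lie_def]

end Pi

variable {g : Type*} [LieRing g] [LieAlgebra ℂ g] [FiniteDimensional ℂ g]
  [LieAlgebra.IsSimple ℂ g] {H : LieSubalgebra ℂ g} [H.IsCartanSubalgebra]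

variable (b : (LieAlgebra.IsKilling.rootSystem H).Base)
  (A : Type*) [CommRing A] [Algebra ℂ A]


/-- The fundamental weights `ω_i`: the basis of `𝔥^*` dual to the basis of simple coroots. -/
def fundWeight (i : b.support) : Module.Dual ℂ H := b.toCoweightBasis.coord i

/-- The dominant integral weights `P^+`: the `ℕ`-span of the fundamental weights. -/
def dominantWeights : AddSubmonoid (Module.Dual ℂ H) :=
  AddSubmonoid.closure (Set.range (fundWeight b))

/-- `𝔫^+`: the sum of the root spaces of the positive roots. -/
def nPlus : Submodule ℂ g :=
  ⨆ α : {α : H.root // b.IsPos α}, (LieAlgebra.rootSpace H (α.1.1 : H → ℂ)).toSubmodule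

theorem lie_mem_nPlus {x : g} (hx : x ∈ nPlus b) (h : H) : ⁅x, (h : g)⁆ ∈ nPlus b := by
  rw [nPlus] at hx
  induction hx using Submodule.iSup_induction' with
  | mem i x hx =>
    rw [← lie_skew]
    refine neg_mem (Submodule.mem_iSup_of_mem i ?_)
    exact LieSubmodule.lie_mem (LieAlgebra.rootSpace H (i.1.1 : H → ℂ)) (x := h) hx
  | zero => simp
  | add x y _ _ hx hy => rw [add_lie]; exact add_mem hx hy

/-- The universal enveloping algebra of `𝔞 ⊗ A`. -/
abbrev UA (A a : Type*) [CommRing A] [Algebra ℂ A] [LieRing a] [LieAlgebra ℂ a] :=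
  UniversalEnvelopingAlgebra ℂ (A ⊗[ℂ] a)

/-- The element `x ⊗ a` of `U(𝔞 ⊗ A)`. -/
def cur {A a : Type*} [CommRing A] [Algebra ℂ A] [LieRing a] [LieAlgebra ℂ a] (c : A) (x : a) :
    UA A a := UniversalEnvelopingAlgebra.ι ℂ (c ⊗ₜ[ℂ] x)

section UEA

attribute [local instance 100] LieRing.ofAssociativeRing

theorem uea_induction {L : Type*} [LieRing L] [LieAlgebra ℂ L]
    {C : UniversalEnvelopingAlgebra ℂ L → Prop}
    (hc : ∀ c : ℂ, C (algebraMap ℂ _ c)) (hι : ∀ x, C (UniversalEnvelopingAlgebra.ι ℂ x))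
    (hm : ∀ u v, C u → C v → C (u * v)) (ha : ∀ u v, C u → C v → C (u + v)) (u) : C u := by
  obtain ⟨t, rfl⟩ : ∃ t, UniversalEnvelopingAlgebra.mkAlgHom ℂ L t = u :=
    RingCon.mkₐ_surjective _ u
  induction t using TensorAlgebra.induction with
  | algebraMap r => simpa using hc r
  | ι x => exact hι x
  | mul u v hu hv => rw [map_mul]; exact hm _ _ hu hv
  | add u v hu hv => rw [map_add]; exact ha _ _ hu hv

theorem uea_comm {L : Type*} [LieRing L] [LieAlgebra ℂ L] (x y : L) :
    UniversalEnvelopingAlgebra.ι ℂ x * UniversalEnvelopingAlgebra.ι ℂ y =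
      UniversalEnvelopingAlgebra.ι ℂ y * UniversalEnvelopingAlgebra.ι ℂ x +
      UniversalEnvelopingAlgebra.ι ℂ ⁅x, y⁆ := by
  rw [LieHom.map_lie, LieRing.of_associative_ring_bracket]; abel

variable {A} {a : Type*} [LieRing a] [LieAlgebra ℂ a]

theorem cur_comm (c d : A) (x y : a) :
    cur c x * cur d y = cur d y * cur c x + cur (c * d) ⁅x, y⁆ := by
  simp only [cur]
  rw [uea_comm, LieAlgebra.ExtendScalars.bracket_tmul]

theorem cur_smul (c : A) (r : ℂ) (x : a) : cur c (r • x) = r • cur c x := by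
  simp [cur, TensorProduct.tmul_smul]

theorem cur_zero (c : A) : cur c (0 : a) = 0 := by
  simp [cur]

end UEA

/-- The defining relations of the global Weyl module of highest weight `lam`:
`(𝔫^+ ⊗ A) w = 0`, `h w = lam(h) w` for `h ∈ 𝔥`, and `y ^ (lam(h_i) + 1) w = 0` for every `y` in the
(one-dimensional) root space `𝔤_{-α_i}` of a simple root `α_i` with coroot `h_i`. -/
def weylRelations (lam : Module.Dual ℂ H) : Set (UA A g) :=
  {u | ∃ a : A, ∃ x ∈ nPlus b, u = cur a x} ∪
  {u | ∃ h : H, u = cur 1 (h : g) - algebraMap ℂ _ (lam h)} ∪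
  {u | ∃ i : b.support, ∃ y ∈ LieAlgebra.rootSpace H (-(i.1.1 : H → ℂ)), ∃ n : ℕ,
    lam (LieAlgebra.IsKilling.coroot i.1.1) = n ∧ u = cur 1 y ^ (n + 1)}

/-- The left ideal of `U(𝔤 ⊗ A)` generated by the defining relations. -/
def weylIdeal (lam : Module.Dual ℂ H) : Submodule (UA A g) (UA A g) :=
  Submodule.span _ (weylRelations b A lam)

/-- The global Weyl module `W_A(lam)`, the quotient of `U(𝔤 ⊗ A)` by this left ideal. -/
def GlobalWeyl (lam : Module.Dual ℂ H) : Type _ := UA A g ⧸ weylIdeal b A lam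

section Weyl

variable (lam : Module.Dual ℂ H)

instance : AddCommGroup (GlobalWeyl b A lam) := inferInstanceAs (AddCommGroup (_ ⧸ _))
instance : Module (UA A g) (GlobalWeyl b A lam) := inferInstanceAs (Module (UA A g) (_ ⧸ _))
instance : Module ℂ (GlobalWeyl b A lam) := inferInstanceAs (Module ℂ (_ ⧸ _))
instance : IsScalarTower ℂ (UA A g) (GlobalWeyl b A lam) :=
  inferInstanceAs (IsScalarTower ℂ (UA A g) (_ ⧸ _))

/-- The generator `w_lam`. -/
def wgen : GlobalWeyl b A lam := Submodule.Quotient.mk 1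

instance : LieRingModule (A ⊗[ℂ] g) (GlobalWeyl b A lam) where
  bracket x w := UniversalEnvelopingAlgebra.ι ℂ x • w
  add_lie x y w := by simp [add_smul]
  lie_add x v w := by simp
  leibniz_lie x y w := by
    rw [← mul_smul, uea_comm, add_smul, mul_smul, add_comm]

theorem lie_weyl (x : A ⊗[ℂ] g) (w : GlobalWeyl b A lam) :
    ⁅x, w⁆ = UniversalEnvelopingAlgebra.ι ℂ x • w := rfl

instance : LieModule ℂ (A ⊗[ℂ] g) (GlobalWeyl b A lam) where
  smul_lie c x w := by simp [lie_weyl]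
  lie_smul c x w := by simp only [lie_weyl]; exact smul_algebra_smul_comm ..

variable {A}

theorem exists_sl2 (i : b.support) (y : g)
    (hy : y ∈ LieAlgebra.rootSpace H (-(i.1.1 : H → ℂ))) :
    ∃ e ∈ nPlus b, ∃ h : H, ∃ f : g, ⁅e, f⁆ = h ∧ (∀ k : H, ⁅(k : g), f⁆ = -(i.1.1 k) • f) ∧
      i.1.1 h = 2 ∧ ∃ c : ℂ, y = c • f := by
  have hα : i.1.1.IsNonZero := (Finset.mem_filter.mp i.1.2).2
  obtain ⟨h, e, f, ht, he, hf⟩ := LieAlgebra.IsKilling.exists_isSl2Triple_of_weight_isNonZero hα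
  have hh := ht.h_eq_coroot hα he hf
  refine ⟨e, ?_, LieAlgebra.IsKilling.coroot i.1.1, f, ?_, ?_, ?_, ?_⟩
  · exact Submodule.mem_iSup_of_mem (⟨i.1, b.isPos_of_mem_support i.2⟩ : {α // b.IsPos α}) he
  · rw [ht.lie_e_f, hh]
  · intro k
    exact LieAlgebra.IsKilling.lie_eq_smul_of_mem_rootSpace hf k
  · exact LieAlgebra.IsKilling.root_apply_coroot hα
  · obtain ⟨c, hc⟩ := (finrank_eq_one_iff_of_nonzero'
      (⟨f, hf⟩ : LieAlgebra.rootSpace H (-(i.1.1 : H → ℂ)))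
      (by simpa using ht.f_ne_zero)).mp
      (LieAlgebra.IsKilling.finrank_rootSpace_eq_one (-i.1.1) (by simpa using hα)) ⟨y, hy⟩
    exact ⟨c, by simpa using congrArg Subtype.val hc.symm⟩

theorem comm_pow {R : Type*} [Ring R] [Algebra ℂ R] {F K G : R} {c : ℂ}
    (h1 : K * F = F * K - c • G) (h2 : G * F = F * G) (n : ℕ) :
    K * F ^ (n + 1) = F ^ (n + 1) * K - ((n + 1 : ℂ) * c) • (F ^ n * G) := by
  have h3 : ∀ n, G * F ^ n = F ^ n * G := fun n => (Commute.pow_right h2 n)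
  induction n with
  | zero => simp [h1]
  | succ n ih =>
    rw [pow_succ', ← mul_assoc, h1, sub_mul, mul_assoc, ih, mul_sub, smul_mul_assoc, h3,
      mul_smul_comm]
    simp only [← mul_assoc, ← pow_succ']
    push_cast
    module

theorem comm_pow' {R : Type*} [Ring R] [Algebra ℂ R] {E F K G : R}
    (h0 : E * F = F * E + K) (h1 : K * F = F * K - (2 : ℂ) • G) (h2 : G * F = F * G) (n : ℕ) :
    E * F ^ (n + 2) = F ^ (n + 2) * E + (n + 2 : ℂ) • (F ^ (n + 1) * K)
      - ((n + 2 : ℂ) * (n + 1)) • (F ^ n * G) := by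
  induction n with
  | zero =>
    have : E * F ^ 2 = F ^ 2 * E + F * K + K * F := by
      rw [pow_two, ← mul_assoc, h0, add_mul, mul_assoc, h0, mul_add, ← mul_assoc]
    rw [zero_add, this, h1]
    simp [two_smul]
    abel
  | succ n ih =>
    have e : F * (F ^ n * G) = F ^ (n + 1) * G := by rw [← mul_assoc, ← pow_succ']
    rw [pow_succ', ← mul_assoc, h0, add_mul, mul_assoc, ih, comm_pow h1 h2 (n + 1)]
    simp only [mul_add, mul_sub, mul_smul_comm, e]
    simp only [← mul_assoc, ← pow_succ']
    push_cast
    module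

theorem rel_mul_mem (a : A) (k : H) {u : UA A g} (hu : u ∈ weylRelations b A lam) :
    u * cur a (k : g) ∈ weylIdeal b A lam := by
  have hI : ∀ (v : UA A g) {u}, u ∈ weylIdeal b A lam → v * u ∈ weylIdeal b A lam :=
    fun v u hu => Submodule.smul_mem _ v hu
  have hn : ∀ (c : A) {x : g}, x ∈ nPlus b → cur c x ∈ weylIdeal b A lam := fun c x hx =>
    Submodule.subset_span (Or.inl (Or.inl ⟨c, x, hx, rfl⟩))
  have hu' : u ∈ weylIdeal b A lam := Submodule.subset_span hu
  rcases hu with (⟨c, x, hx, rfl⟩ | ⟨h, rfl⟩) | ⟨i, y, hy, n, hn', rfl⟩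
  · rw [cur_comm]
    exact add_mem (hI _ hu') (hn _ (lie_mem_nPlus b hx k))
  · have h0 : ⁅(h : g), (k : g)⁆ = 0 := by
      rw [← LieSubalgebra.coe_bracket, trivial_lie_zero]; rfl
    have : (cur 1 (h : g) - algebraMap ℂ (UA A g) (lam h)) * cur a (k : g) =
        cur a (k : g) * (cur 1 (h : g) - algebraMap ℂ _ (lam h)) := by
      rw [sub_mul, mul_sub, cur_comm, h0, cur_zero, add_zero, Algebra.commutes]
    rw [this]
    exact hI _ hu'
  · obtain ⟨e, he, h, f, hef, hf, h2, c, rfl⟩ := exists_sl2 b i y hy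
    by_cases hc : c = 0
    · subst hc; rw [zero_smul, cur_zero, zero_pow (Nat.succ_ne_zero n), zero_mul]; exact zero_mem _
    set F : UA A g := cur 1 f with hF
    set G : UA A g := cur a f with hG
    set X : UA A g := cur a (h : g) with hX
    have c2 : G * F = F * G := by rw [hG, hF, cur_comm, lie_self, cur_zero, add_zero]
    have ck : ∀ k : H, cur a (k : g) * F = F * cur a (k : g) - (i.1.1 k) • G := by
      intro k
      rw [hF, cur_comm, hf, mul_one, cur_smul, neg_smul, sub_eq_add_neg]
    have c1 : X * F = F * X - (2 : ℂ) • G := by rw [hX, ck, h2]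
    have c0 : cur a e * F = F * cur a e + X := by rw [hF, cur_comm, hef, mul_one]
    have hFn : F ^ (n + 1) ∈ weylIdeal b A lam := by
      have : F ^ (n + 1) = algebraMap ℂ (UA A g) ((c ^ (n + 1))⁻¹) * cur 1 (c • f) ^ (n + 1) := by
        rw [cur_smul, smul_pow, ← Algebra.smul_def, smul_smul, inv_mul_cancel₀ (pow_ne_zero _ hc),
          one_smul]
      rw [this]
      exact hI _ hu'
    have sm : ∀ (r : ℂ) {v}, v ∈ weylIdeal b A lam → r • v ∈ weylIdeal b A lam := by
      intro r v hv
      rw [Algebra.smul_def]; exact hI _ hv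
    have m1 : (n + 2 : ℂ) • (F ^ (n + 1) * X) - ((n + 2 : ℂ) * (n + 1)) • (F ^ n * G) ∈
        weylIdeal b A lam := by
      have := comm_pow' c0 c1 c2 n
      have h3 : (n + 2 : ℂ) • (F ^ (n + 1) * X) - ((n + 2 : ℂ) * (n + 1)) • (F ^ n * G) =
          cur a e * F * F ^ (n + 1) - F ^ (n + 2) * cur a e := by
        rw [mul_assoc, ← pow_succ', this]; abel
      rw [h3]
      exact sub_mem (hI _ hFn) (hI _ (hn _ he))
    have m2 : F ^ (n + 1) * X - ((n + 1 : ℂ) * 2) • (F ^ n * G) ∈ weylIdeal b A lam := by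
      rw [← comm_pow c1 c2 n]; exact hI _ hFn
    have m3 : F ^ n * G ∈ weylIdeal b A lam := by
      have hne : ((n + 2 : ℂ) * (n + 1)) ≠ 0 := by
        norm_cast
      have := sm (((n + 2 : ℂ) * (n + 1))⁻¹) (sub_mem m1 (sm (n + 2 : ℂ) m2))
      have e : (n + 2 : ℂ) • (F ^ (n + 1) * X) - ((n + 2 : ℂ) * (n + 1)) • (F ^ n * G) -
          (n + 2 : ℂ) • (F ^ (n + 1) * X - ((n + 1 : ℂ) * 2) • (F ^ n * G)) =
          ((n + 2 : ℂ) * (n + 1)) • (F ^ n * G) := by module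
      rwa [e, smul_smul, inv_mul_cancel₀ hne, one_smul] at this
    rw [cur_smul, smul_pow, smul_mul_assoc]
    refine sm _ ?_
    have := comm_pow (ck k) c2 n
    rw [eq_sub_iff_add_eq] at this
    rw [← this]
    exact add_mem (hI _ hFn) (sm _ m3)

end Weyl

section Cartan

attribute [local instance 100] LieRing.ofAssociativeRing

variable {A}

/-- The inclusion `𝔥 ⊗ A → 𝔤 ⊗ A`. -/
def cartanIncl (A : Type*) [CommRing A] [Algebra ℂ A] (H : LieSubalgebra ℂ g) :
    A ⊗[ℂ] H →ₗ⁅ℂ⁆ A ⊗[ℂ] g :=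
  { LinearMap.lTensor A H.toSubmodule.subtype with
    map_lie' := by
      intro x y
      induction x using TensorProduct.induction_on with
      | zero => simp
      | add x x' hx hx' => simp_all [add_lie]
      | tmul c x =>
        induction y using TensorProduct.induction_on with
        | zero => simp
        | add y y' hy hy' => simp_all [lie_add]
        | tmul d y => simp [LieAlgebra.ExtendScalars.bracket_tmul] }

/-- The homomorphism `U(𝔥 ⊗ A) → U(𝔤 ⊗ A)` induced by the inclusion. -/
def cartanMap (A : Type*) [CommRing A] [Algebra ℂ A] (H : LieSubalgebra ℂ g) :
    UA A H →ₐ[ℂ] UA A g :=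
  UniversalEnvelopingAlgebra.lift ℂ
    ((UniversalEnvelopingAlgebra.ι ℂ).comp (cartanIncl A H))

theorem cartanMap_cur (c : A) (h : H) : cartanMap A H (cur c h) = cur c (h : g) := by
  rw [cartanMap, cur, UniversalEnvelopingAlgebra.lift_ι_apply]
  rfl

theorem ind_cur {a : Type*} [LieRing a] [LieAlgebra ℂ a] {C : UA A a → Prop}
    (hc : ∀ c : ℂ, C (algebraMap ℂ _ c)) (hι : ∀ (c : A) (x : a), C (cur c x))
    (hm : ∀ u v, C u → C v → C (u * v)) (ha : ∀ u v, C u → C v → C (u + v)) (u) : C u := by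
  refine uea_induction hc (fun x => ?_) hm ha u
  induction x using TensorProduct.induction_on with
  | zero => rw [map_zero]; simpa using hc 0
  | tmul c x => exact hι c x
  | add x y hx hy => rw [map_add]; exact ha _ _ hx hy

/-- `U(𝔥 ⊗ A)` is commutative, since `𝔥` is abelian. -/
instance cartanCommRing : CommRing (UA A H) where
  mul_comm p q := by
    have h1 : ∀ (c d : A) (x y : H), cur c x * cur d y = cur d y * cur c x := by
      intro c d x y
      rw [cur_comm, trivial_lie_zero, cur_zero, add_zero]
    refine ind_cur (C := fun p => p * q = q * p) (fun c => Algebra.commutes c q)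
      (fun c x => ?_) (fun u v hu hv => (Commute.mul_left hu hv))
      (fun u v hu hv => (Commute.add_left hu hv)) p
    exact ind_cur (C := fun q => cur c x * q = q * cur c x) (fun c => (Algebra.commutes c _).symm)
      (fun d y => h1 c d x y) (fun u v hu hv => (Commute.mul_right hu hv))
      (fun u v hu hv => (Commute.add_right hu hv)) q

variable (lam : Module.Dual ℂ H)

theorem mul_cartan_mem (p : UA A H) :
    ∀ u ∈ weylIdeal b A lam, u * cartanMap A H p ∈ weylIdeal b A lam := by
  refine ind_cur (C := fun p => ∀ u ∈ weylIdeal b A lam, u * cartanMap A H p ∈ weylIdeal b A lam)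
    ?_ ?_ ?_ ?_ p
  · intro c u hu
    rw [AlgHom.commutes, ← Algebra.commutes]
    exact Submodule.smul_mem _ _ hu
  · intro c h u hu
    rw [cartanMap_cur]
    induction hu using Submodule.span_induction with
    | mem u hu => exact rel_mul_mem b lam c h hu
    | zero => simp
    | add u v _ _ hu hv => rw [add_mul]; exact add_mem hu hv
    | smul r u _ hu => rw [smul_eq_mul, mul_assoc]; exact Submodule.smul_mem _ r hu
  · intro p q hp hq u hu
    rw [map_mul, ← mul_assoc]
    exact hq _ (hp _ hu)
  · intro p q hp hq u hu
    rw [map_add, mul_add]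
    exact add_mem (hp _ hu) (hq _ hu)

/-- The right action of `p ∈ U(𝔥 ⊗ A)` on `W_A(lam)`: `(u w_lam) p = u p w_lam`. -/
def rightAct (p : UA A H) : GlobalWeyl b A lam →ₗ[UA A g] GlobalWeyl b A lam :=
  Submodule.mapQ (weylIdeal b A lam) (weylIdeal b A lam)
    (LinearMap.toSpanSingleton (UA A g) (UA A g) (cartanMap A H p))
    (fun u hu => mul_cartan_mem b lam p u hu)

theorem rightAct_wgen (p : UA A H) :
    rightAct b lam p (wgen b A lam) = cartanMap A H p • wgen b A lam := by
  change Submodule.Quotient.mk ((1 : UA A g) * cartanMap A H p) =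
    Submodule.Quotient.mk (cartanMap A H p * 1)
  rw [one_mul, mul_one]

theorem exists_smul_wgen (w : GlobalWeyl b A lam) : ∃ u : UA A g, w = u • wgen b A lam := by
  obtain ⟨u, rfl⟩ := Submodule.Quotient.mk_surjective _ w
  refine ⟨u, ?_⟩
  change _ = Submodule.Quotient.mk (u * 1)
  rw [mul_one]

/-- The right action of `U(𝔥 ⊗ A)` on `W_A(lam)` as an algebra homomorphism. -/
def rightActHom : UA A H →ₐ[ℂ] Module.End ℂ (GlobalWeyl b A lam) where
  toFun p := (rightAct b lam p).restrictScalars ℂ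
  map_one' := by
    ext w; obtain ⟨u, rfl⟩ := exists_smul_wgen b lam w
    simp [rightAct_wgen]
  map_mul' p q := by
    ext w; obtain ⟨u, rfl⟩ := exists_smul_wgen b lam w
    rw [mul_comm p q]
    simp [rightAct_wgen, mul_smul]
  map_zero' := by
    ext w; obtain ⟨u, rfl⟩ := exists_smul_wgen b lam w
    simp [rightAct_wgen]
  map_add' p q := by
    ext w; obtain ⟨u, rfl⟩ := exists_smul_wgen b lam w
    simp [rightAct_wgen, add_smul]
  commutes' c := by
    ext w; obtain ⟨u, rfl⟩ := exists_smul_wgen b lam w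
    simp [rightAct_wgen, smul_algebra_smul_comm]

/-- The annihilator of `w_lam` in `U(𝔥 ⊗ A)`. -/
def annGen (A : Type*) [CommRing A] [Algebra ℂ A] (lam : Module.Dual ℂ H) : Ideal (UA A H) where
  carrier := {p | cartanMap A H p • wgen b A lam = 0}
  zero_mem' := by simp
  add_mem' hp hq := by
    simp only [Set.mem_ofPred_eq] at hp hq ⊢
    rw [map_add, add_smul, hp, hq, add_zero]
  smul_mem' p q hq := by
    simp only [Set.mem_ofPred_eq] at hq ⊢
    rw [smul_eq_mul, map_mul, mul_smul, hq, smul_zero]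

/-- The algebra `𝐀_lam = U(𝔥 ⊗ A) / Ann(w_lam)`. It is commutative, so its right modules are
written as (left) modules below. -/
def WeylAlg (A : Type*) [CommRing A] [Algebra ℂ A] (lam : Module.Dual ℂ H) : Type _ :=
  UA A H ⧸ annGen b A lam

instance : CommRing (WeylAlg b A lam) := inferInstanceAs (CommRing (_ ⧸ annGen b A lam))
instance : Algebra ℂ (WeylAlg b A lam) := inferInstanceAs (Algebra ℂ (_ ⧸ annGen b A lam))

/-- The right action of `𝐀_lam` on `W_A(lam)`. -/
def weylAlgAct (lam : Module.Dual ℂ H) :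
    WeylAlg b A lam →ₐ[ℂ] Module.End ℂ (GlobalWeyl b A lam) :=
  Ideal.Quotient.liftₐ _ (rightActHom b lam) (by
    intro p hp
    have hp' : cartanMap A H p • wgen b A lam = 0 := hp
    ext w; obtain ⟨u, rfl⟩ := exists_smul_wgen b lam w
    simp [rightActHom, rightAct_wgen, hp'])

theorem weylAlgAct_lie (p : WeylAlg b A lam) (x : A ⊗[ℂ] g) (w : GlobalWeyl b A lam) :
    weylAlgAct b lam p ⁅x, w⁆ = ⁅x, weylAlgAct b lam p w⁆ := by
  obtain ⟨p, rfl⟩ := Ideal.Quotient.mk_surjective p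
  exact map_smul (rightAct b lam p) _ _

end Cartan

section Tensor

variable (s : b.support → ℕ)

/-- The index set of the factors: `s i` copies of each `i`. -/
abbrev Factors : Type _ := Σ i : b.support, Fin (s i)

/-- `W_A(𝐬) = ⨂_i W_A(ω_i)^{⊗ s_i}`. -/
abbrev WeylTensor : Type _ := ⨂[ℂ] j : Factors b s, GlobalWeyl b A (fundWeight b j.1)

/-- `𝐀_𝐬 = ⨂_i 𝐀_{ω_i}^{⊗ s_i}`. -/
abbrev WeylTensorAlg : Type _ := ⨂[ℂ] j : Factors b s, WeylAlg b A (fundWeight b j.1)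

/-- The factorwise action of `𝐀_𝐬` on `W_A(𝐬)`. -/
def tensorAlgAct : WeylTensorAlg b A s →ₐ[ℂ] Module.End ℂ (WeylTensor b A s) :=
  PiTensorProduct.liftAlgHom
    ((PiTensorProduct.mapMultilinear ℂ _ _).compLinearMap
      fun j => (weylAlgAct b (A := A) (fundWeight b j.1)).toLinearMap)
    (by simp)
    (by
      intro x y
      simp [← PiTensorProduct.map_mul])

instance : Module (WeylTensorAlg b A s) (WeylTensor b A s) :=
  Module.compHom _ (tensorAlgAct b A s).toRingHom

theorem tensorAlgAct_smul_def (p : WeylTensorAlg b A s) (t : WeylTensor b A s) :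
    p • t = tensorAlgAct b A s p t := rfl

theorem tensorAlgAct_tprod
    (p : ∀ j : Factors b s, WeylAlg b A (fundWeight b j.1))
    (m : ∀ j : Factors b s, GlobalWeyl b A (fundWeight b j.1)) :
    tensorAlgAct b A s (PiTensorProduct.tprod ℂ p) (PiTensorProduct.tprod ℂ m) =
      PiTensorProduct.tprod ℂ fun j : Factors b s =>
        (weylAlgAct b (A := A) (fundWeight b j.1) (p j) :
          Module.End ℂ (GlobalWeyl b A (fundWeight b j.1))) (m j) := by
  rw [tensorAlgAct, PiTensorProduct.liftAlgHom_apply, PiTensorProduct.lift.tprod]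
  exact PiTensorProduct.map_tprod _ _

theorem tensorAlgAct_lie (p : WeylTensorAlg b A s) (x : A ⊗[ℂ] g) (t : WeylTensor b A s) :
    p • ⁅x, t⁆ = ⁅x, p • t⁆ := by
  classical
  simp only [tensorAlgAct_smul_def]
  induction p using PiTensorProduct.induction_on with
  | add p q hp hq => simp only [map_add, LinearMap.add_apply, hp, hq, lie_add]
  | smul_tprod r p =>
    induction t using PiTensorProduct.induction_on with
    | add t u ht hu => simp only [map_add, lie_add, ht, hu]
    | smul_tprod c m =>
      simp only [map_smul, LinearMap.smul_apply, lie_smul, lie_def, tensorAct_tprod, map_sum,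
        tensorAlgAct_tprod]
      rw [← Finset.smul_sum]
      congr 2
      refine Finset.sum_congr rfl fun j _ => ?_
      congr 1
      funext i
      by_cases h : i = j
      · subst h; simp [weylAlgAct_lie]
      · simp [h]

/-- `Hom_{𝔤 ⊗ A}(W_A(μ), W_A(𝐬))` is an `𝐀_𝐬`-module through the action on the target. -/
instance homModule (mu : Module.Dual ℂ H) :
    Module (WeylTensorAlg b A s)
      (GlobalWeyl b A mu →ₗ⁅ℂ, A ⊗[ℂ] g⁆ WeylTensor b A s) where
  smul p f :=
    { (tensorAlgAct b A s p) ∘ₗ (f : GlobalWeyl b A mu →ₗ[ℂ] WeylTensor b A s) with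
      map_lie' := by
        intro x w
        have h := tensorAlgAct_lie b A s p x (f w)
        rw [← LieModuleHom.map_lie] at h
        exact h }
  one_smul f := LieModuleHom.ext fun w => one_smul (WeylTensorAlg b A s) (f w)
  mul_smul p q f := LieModuleHom.ext fun w => mul_smul p q (f w)
  smul_zero p := LieModuleHom.ext fun _ => smul_zero p
  smul_add p f f' := LieModuleHom.ext fun w => smul_add p (f w) (f' w)
  add_smul p q f := LieModuleHom.ext fun w => add_smul p q (f w)
  zero_smul f := LieModuleHom.ext fun w => zero_smul (WeylTensorAlg b A s) (f w)

end Tensor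

section Invariants

variable (M : Type*) [AddCommGroup M] [Module ℂ M] [LieRingModule (A ⊗[ℂ] g) M]
  [LieModule ℂ (A ⊗[ℂ] g) M]

/-- The space `M^{𝔫^+ ⊗ A}` of `𝔫^+ ⊗ A`-invariants. -/
def invariants : Submodule ℂ M where
  carrier := {v | ∀ (a : A), ∀ x ∈ nPlus b, ⁅a ⊗ₜ[ℂ] x, v⁆ = 0}
  zero_mem' := by simp
  add_mem' hv hw a x hx := by rw [lie_add, hv a x hx, hw a x hx, add_zero]
  smul_mem' c v hv a x hx := by rw [lie_smul, hv a x hx, smul_zero]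

/-- The weight space `M_μ` for the action of `𝔥 = 𝔥 ⊗ 1`. -/
def weightSpace (mu : Module.Dual ℂ H) : Submodule ℂ M where
  carrier := {v | ∀ h : H, ⁅(1 : A) ⊗ₜ[ℂ] (h : g), v⁆ = mu h • v}
  zero_mem' := by simp
  add_mem' hv hw h := by rw [lie_add, hv h, hw h, smul_add]
  smul_mem' c v hv h := by rw [lie_smul, hv h, smul_comm]

end Invariants

variable (s : b.support → ℕ)

/-- `W_A(𝐬)^{𝔫^+ ⊗ A}_μ = W_A(𝐬)^{𝔫^+ ⊗ A} ∩ W_A(𝐬)_μ`, as an `𝐀_𝐬`-submodule. -/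
def invariantWeightSpace (mu : Module.Dual ℂ H) :
    Submodule (WeylTensorAlg b A s) (WeylTensor b A s) where
  carrier := {v | v ∈ invariants b A (WeylTensor b A s) ∧ v ∈ weightSpace A (WeylTensor b A s) mu}
  zero_mem' := ⟨zero_mem _, zero_mem _⟩
  add_mem' hv hw := ⟨add_mem hv.1 hw.1, add_mem hv.2 hw.2⟩
  smul_mem' p v hv := by
    refine ⟨fun a x hx => ?_, fun h => ?_⟩
    · rw [← tensorAlgAct_lie, hv.1 a x hx, smul_zero]
    · rw [← tensorAlgAct_lie, hv.2 h, tensorAlgAct_smul_def, tensorAlgAct_smul_def, map_smul]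

/-- `⨂_i (W_A(ω_i)^{𝔫^+ ⊗ A})^{⊗ s_i}` as a subspace of `W_A(𝐬)`. -/
def tensorInvariants : Submodule ℂ (WeylTensor b A s) :=
  LinearMap.range (PiTensorProduct.mapIncl
    fun j : Factors b s => invariants b A (GlobalWeyl b A (fundWeight b j.1)))

/-- `R_{k,ℓ} = ℂ[t₁^{±1}, …, t_k^{±1}, u₁, …, u_ℓ]`, the algebra of the monoid `ℤ^k × ℕ^ℓ` of
exponents. -/
abbrev LaurentPoly (k l : ℕ) : Type := AddMonoidAlgebra ℂ ((Fin k → ℤ) × (Fin l → ℕ))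

end WeylHom

end

/-! A homomorphism out of `W_A(μ)` is determined by the image of the cyclic generator, which is a
highest weight vector of weight `μ`. Conversely a highest weight vector `v` of `W_A(𝐬)` satisfies
the remaining relation: the lowering operators `y ⊗ 1` of simple roots act locally nilpotently on
each factor, hence on the tensor product, and `sl₂` theory then forces `(y ⊗ 1) ^ (μ(h_i) + 1) v =
0`. Evaluation at the generator commutes with the action of `𝐀_𝐬` on the target, which gives the
first claim.

For the second claim the point is to separate the tensor factors. Since `ω_i(h_i) = 1` and `ω_i(h_j)
= 0` for `j ≠ i`, right multiplication by `h_i ⊗ a` defines an algebra homomorphism `a ↦ T_a` from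
`A` to the endomorphisms of `W_A(ω_i)` (`fundAct`). The function `c ↦ (x ⊗ c) m` is a generalized
eigenvector, with eigenvalue the operator `T_a`, for multiplication of the argument `c` by `a`, with
exponent independent of `x` and `m` (`exists_shiftOp_pow_eq_zero`).

If `v` is invariant, then the functions `c ↦ (x ⊗ c)_j v`, with `x ⊗ c` acting in slot `j` only, sum
to zero over `j`. They are generalized eigenvectors for the commuting operators `T_a` in the various
slots. If `T_a` has no eigenvectors, the difference of two such operators in distinct slots is
injective (`eq_zero_of_slotMap_eq`), so every summand vanishes (`eq_zero_of_sum_eq_zero`). Thus `v`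
is invariant slot by slot, and contractions place it in the tensor product of the invariants
(`mem_range_mapIncl_of_contract`).

Finally, for `a` a variable of the Laurent polynomial ring, `T_a` has no eigenvectors: translating
or rescaling the variable induces a locally finite automorphism of `W_A(ω_i)` that moves an
eigenvalue through infinitely many values, impossible in a finite-dimensional stable subspace. -/

open scoped TensorProduct

noncomputable section

namespace WeylHom

/-! ### Operators on single slots of a tensor product, and contractions. -/

section PiTensorLinearAlgebra

variable {K ι : Type*} [Field K] {M : ι → Type*} [∀ i, AddCommGroup (M i)] [∀ i, Module K (M i)]

open Classical in
/-- The endomorphism of a tensor product acting by `S` on the factor `j`. -/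
def slotMap (j : ι) : Module.End K (M j) →ₐ[K] Module.End K (⨂[K] i, M i) :=
  AlgHom.ofLinearMap
    { toFun := fun S => PiTensorProduct.map
        (Function.update (fun i => (LinearMap.id : M i →ₗ[K] M i)) j S)
      map_add' := fun S T => PiTensorProduct.map_update_add _ _ _ _
      map_smul' := fun c S => PiTensorProduct.map_update_smul _ _ _ _ }
    (by
      have : Function.update (fun i => (LinearMap.id : M i →ₗ[K] M i)) j 1 =
          fun i => LinearMap.id := Function.update_eq_self _ _
      change PiTensorProduct.map (Function.update (fun i => (LinearMap.id : M i →ₗ[K] M i)) j 1) = 1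
      rw [this, PiTensorProduct.map_id]; rfl)
    (by
      intro S T
      change PiTensorProduct.map _ = PiTensorProduct.map _ * PiTensorProduct.map _
      rw [← PiTensorProduct.map_mul]
      congr 1
      funext i
      by_cases h : i = j
      · subst h; simp
      · simp only [Function.update_of_ne h]; rfl)

open Classical in
theorem slotMap_tprod (j : ι) (S : Module.End K (M j)) (m : ∀ i, M i) :
    slotMap j S (PiTensorProduct.tprod K m) =
      PiTensorProduct.tprod K (Function.update m j (S (m j))) := by
  change PiTensorProduct.map _ _ = _
  rw [PiTensorProduct.map_tprod]
  congr 1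
  funext i
  by_cases h : i = j
  · subst h; simp
  · simp [h]

theorem slotMap_commute {i j : ι} (h : i ≠ j) (S : Module.End K (M i)) (T : Module.End K (M j)) :
    Commute (slotMap (M := M) i S) (slotMap j T) := by
  classical
  apply PiTensorProduct.ext
  ext m
  simp only [LinearMap.compMultilinearMap_apply, Module.End.mul_apply, slotMap_tprod,
    Function.update_of_ne h, Function.update_of_ne h.symm]
  rw [Function.update_comm h]

variable [Fintype ι]

open Classical in
/-- Contraction of all factors but the factor `j` against the linear forms `f`. -/
def contract (j : ι) (f : ∀ i, Module.Dual K (M i)) : (⨂[K] i, M i) →ₗ[K] M j :=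
  PiTensorProduct.lift
    { toFun := fun m => (∏ i ∈ Finset.univ.erase j, f i (m i)) • m j
      map_update_add' := by
        intro inst m i x y
        obtain rfl : inst = Classical.decEq ι := Subsingleton.elim _ _
        by_cases h : i = j
        · subst h
          have : ∀ z, ∏ l ∈ Finset.univ.erase i, f l (Function.update m i z l) =
              ∏ l ∈ Finset.univ.erase i, f l (m l) := fun z => Finset.prod_congr rfl fun l hl => by
            rw [Function.update_of_ne (Finset.ne_of_mem_erase hl)]
          simp [this]
        · have hi : i ∈ Finset.univ.erase j := by simp [h]
          have : ∀ z, ∏ l ∈ (Finset.univ.erase j).erase i, f l (Function.update m i z l) =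
              ∏ l ∈ (Finset.univ.erase j).erase i, f l (m l) :=
            fun z => Finset.prod_congr rfl fun l hl => by
              rw [Function.update_of_ne (Finset.ne_of_mem_erase hl)]
          simp only [← Finset.mul_prod_erase _ _ hi, this, Function.update_self, map_add,
            Function.update_of_ne (Ne.symm h), add_mul, add_smul]
      map_update_smul' := by
        intro inst m i c x
        obtain rfl : inst = Classical.decEq ι := Subsingleton.elim _ _
        by_cases h : i = j
        · subst h
          have : ∀ z, ∏ l ∈ Finset.univ.erase i, f l (Function.update m i z l) =
              ∏ l ∈ Finset.univ.erase i, f l (m l) := fun z => Finset.prod_congr rfl fun l hl => by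
            rw [Function.update_of_ne (Finset.ne_of_mem_erase hl)]
          simp [this, smul_comm c]
        · have hi : i ∈ Finset.univ.erase j := by simp [h]
          have : ∀ z, ∏ l ∈ (Finset.univ.erase j).erase i, f l (Function.update m i z l) =
              ∏ l ∈ (Finset.univ.erase j).erase i, f l (m l) :=
            fun z => Finset.prod_congr rfl fun l hl => by
              rw [Function.update_of_ne (Finset.ne_of_mem_erase hl)]
          simp only [← Finset.mul_prod_erase _ _ hi, this, Function.update_self, map_smul,
            Function.update_of_ne (Ne.symm h), smul_eq_mul, mul_assoc, mul_smul] }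

open Classical in
theorem contract_tprod (j : ι) (f : ∀ i, Module.Dual K (M i)) (m : ∀ i, M i) :
    contract j f (PiTensorProduct.tprod K m) =
      (∏ i ∈ Finset.univ.erase j, f i (m i)) • m j := by
  rw [contract, PiTensorProduct.lift.tprod]; rfl

theorem contract_slotMap_self (j : ι) (f : ∀ i, Module.Dual K (M i)) (S : Module.End K (M j))
    (v : ⨂[K] i, M i) : contract j f (slotMap j S v) = S (contract j f v) := by
  classical
  induction v using PiTensorProduct.induction_on with
  | add v w hv hw => simp only [map_add, hv, hw]
  | smul_tprod r m =>
    simp only [map_smul, slotMap_tprod, contract_tprod, Function.update_self]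
    congr 2
    exact Finset.prod_congr rfl fun l hl => by
      rw [Function.update_of_ne (Finset.ne_of_mem_erase hl)]

open Classical in
-- An operator on a contracted slot is absorbed by transposing it onto the linear form there.
theorem contract_slotMap_of_ne {i j : ι} (h : i ≠ j) (f : ∀ i, Module.Dual K (M i))
    (S : Module.End K (M i)) (v : ⨂[K] i, M i) :
    contract j f (slotMap i S v) = contract j (Function.update f i (f i ∘ₗ S)) v := by
  induction v using PiTensorProduct.induction_on with
  | add v w hv hw => simp only [map_add, hv, hw]
  | smul_tprod r m =>
    simp only [map_smul, slotMap_tprod, contract_tprod, Function.update_of_ne h.symm]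
    congr 2
    refine Finset.prod_congr rfl fun l _ => ?_
    by_cases hl : l = i
    · subst hl; simp
    · simp [hl]

/-- In a product basis every coordinate of `v` is a coordinate of its contraction against coordinate
forms, so contractions separate points. -/
theorem eq_zero_of_contract (j : ι) {v : ⨂[K] i, M i}
    (h : ∀ f : ∀ i, Module.Dual K (M i), contract j f v = 0) : v = 0 := by
  classical
  let B := fun i => Module.Basis.ofVectorSpace K (M i)
  refine (Basis.piTensorProduct B).ext_elem fun p => ?_
  have key : ∀ w : ⨂[K] i, M i, (Basis.piTensorProduct B).repr w p =
      (B j).repr (contract j (fun i => (B i).coord (p i)) w) (p j) := by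
    intro w
    induction w using PiTensorProduct.induction_on with
    | add v w hv hw => simp only [map_add, Finsupp.add_apply, hv, hw]
    | smul_tprod r m =>
      simp only [map_smul, Finsupp.smul_apply, contract_tprod, smul_eq_mul,
        Basis.piTensorProduct_repr_tprod_apply, Module.Basis.coord_apply]
      rw [Finset.prod_erase_mul _ _ (Finset.mem_univ j)]
  rw [key, h]
  simp

theorem exists_finite_contract_mem (j : ι) (v : ⨂[K] i, M i) :
    ∃ N : Submodule K (M j), Module.Finite K N ∧ ∀ f, contract j f v ∈ N := by
  classical
  induction v using PiTensorProduct.induction_on with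
  | add v w hv hw =>
    obtain ⟨N, hN, hv⟩ := hv
    obtain ⟨N', hN', hw⟩ := hw
    refine ⟨N ⊔ N', inferInstance, fun f => ?_⟩
    rw [map_add]
    exact Submodule.add_mem_sup (hv f) (hw f)
  | smul_tprod r m =>
    refine ⟨K ∙ (m j), inferInstance, fun f => ?_⟩
    rw [map_smul, contract_tprod]
    exact Submodule.smul_mem _ _ (Submodule.smul_mem _ _ (Submodule.mem_span_singleton_self _))

/-- Over a field each `N j` is the image of a projection. The contraction test shows that the
projection in slot `j` alone fixes `v`; applying these in all slots exhibits `v` as a tensor over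
the `N j`. -/
theorem mem_range_mapIncl_of_contract (N : ∀ i, Submodule K (M i)) {v : ⨂[K] i, M i}
    (h : ∀ j f, contract j f v ∈ N j) : v ∈ LinearMap.range (PiTensorProduct.mapIncl N) := by
  classical
  choose p hp using fun i => LinearMap.exists_leftInverse_of_injective (N i).subtype
    (by simp)
  let P : ∀ i, Module.End K (M i) := fun i => (N i).subtype ∘ₗ p i
  have hP : ∀ i, ∀ m ∈ N i, P i m = m := fun i m hm =>
    congrArg Subtype.val (LinearMap.congr_fun (hp i) ⟨m, hm⟩)
  have hslot : ∀ j, slotMap j (P j) v = v := by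
    intro j
    rw [← sub_eq_zero]
    refine eq_zero_of_contract j fun f => ?_
    rw [map_sub, contract_slotMap_self, hP j _ (h j f), sub_self]
  have hs : ∀ s : Finset ι,
      PiTensorProduct.map (fun j => if j ∈ s then P j else LinearMap.id) v = v := by
    intro s
    induction s using Finset.induction_on with
    | empty => simp
    | insert j s hj ih =>
      have : (fun i => if i ∈ insert j s then P i else LinearMap.id) =
          fun i => Function.update (fun i => (LinearMap.id : M i →ₗ[K] M i)) j (P j) i ∘ₗ
            (if i ∈ s then P i else LinearMap.id) := by
        funext i
        by_cases hi : i = j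
        · subst hi; simp [hj]
        · simp [hi]
      rw [this, PiTensorProduct.map_comp, LinearMap.comp_apply, ih]
      exact hslot j
  have hv := hs Finset.univ
  simp only [Finset.mem_univ, if_true, P] at hv
  rw [PiTensorProduct.map_comp] at hv
  exact ⟨_, hv⟩

/-- If `T` has no eigenvector, then `S` and `T` acting on different factors of a tensor product
never agree on a nonzero vector. -/
theorem eq_zero_of_slotMap_eq [IsAlgClosed K] {i j : ι} (h : i ≠ j) (S : Module.End K (M i))
    (T : Module.End K (M j)) (hT : ∀ (z : K) (m : M j), T m = z • m → m = 0) {v : ⨂[K] i, M i}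
    (hv : slotMap i S v = slotMap j T v) : v = 0 := by
  classical
  -- `N` is finite-dimensional because `v` is a finite sum of pure tensors. It is `T`-stable because
  -- `T` in slot `j` can be traded for `S` in slot `i`, which only changes the form contracted
  -- there.
  let N : Submodule K (M j) := Submodule.span K (Set.range fun f => contract j f v)
  have hfin : Module.Finite K N := by
    obtain ⟨N', hN', h'⟩ := exists_finite_contract_mem j v
    exact Submodule.finiteDimensional_of_le (Submodule.span_le.2 (by rintro _ ⟨f, rfl⟩; exact h' f))
  have hTN : ∀ m ∈ N, T m ∈ N := by
    intro m hm
    induction hm using Submodule.span_induction with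
    | mem m hm =>
      obtain ⟨f, rfl⟩ := hm
      dsimp only
      rw [← contract_slotMap_self, ← hv, contract_slotMap_of_ne h]
      exact Submodule.subset_span ⟨_, rfl⟩
    | zero => simp
    | add x y _ _ hx hy => rw [map_add]; exact add_mem hx hy
    | smul c x _ hx => rw [map_smul]; exact Submodule.smul_mem _ _ hx
  have hN : N = ⊥ := by
    by_contra hne
    have : Nontrivial N := Submodule.nontrivial_iff_ne_bot.2 hne
    obtain ⟨z, hz⟩ := Module.End.exists_eigenvalue (T.restrict hTN)
    obtain ⟨m, hm⟩ := hz.exists_hasEigenvector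
    have := congrArg Subtype.val hm.apply_eq_smul
    exact hm.2 (Subtype.ext (hT z m this))
  refine eq_zero_of_contract j fun f => ?_
  have : contract j f v ∈ N := Submodule.subset_span ⟨f, rfl⟩
  rwa [hN, Submodule.mem_bot] at this

end PiTensorLinearAlgebra

/-! ### Generalized eigenvectors with operators as eigenvalues. -/

section LinearAlgebra

variable {K X : Type*} [Field K] [AddCommGroup X] [Module K X]

/-- By induction on the exponent, `(L - R) x` satisfies the same hypotheses and vanishes; then `R x
= L x = S x`, and injectivity of `R - S` applies. -/
theorem eq_zero_of_sub_pow_apply_eq_zero {L R S : Module.End K X} (hLR : Commute L R)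
    (hLS : Commute L S) (hRS : Commute R S) (hinj : ∀ x, R x = S x → x = 0) {n : ℕ} {x : X}
    (hR : ((L - R) ^ n) x = 0) (hS : L x = S x) : x = 0 := by
  have hc : Commute (L - R) (L - S) :=
    ((Commute.refl L).sub_right hLS).sub_left (hLR.symm.sub_right hRS)
  induction n generalizing x with
  | zero => simpa using hR
  | succ n ih =>
    apply hinj
    have h1 : (L - R) x = 0 := by
      refine ih (x := (L - R) x) (by rw [pow_succ] at hR; exact hR) ?_
      have := LinearMap.congr_fun hc.eq x
      simp only [Module.End.mul_apply, LinearMap.sub_apply, hS, sub_self, map_zero] at this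
      rw [LinearMap.sub_apply, hS]
      exact (sub_eq_zero.1 this.symm)
    rw [LinearMap.sub_apply, sub_eq_zero, hS] at h1
    exact h1.symm

/-- Generalized eigenvectors of `L` with respect to commuting operators `R j` as eigenvalues are
independent as soon as all the differences `R i - R j` are injective. -/
theorem eq_zero_of_sum_eq_zero {ι : Type*} [Fintype ι] {L : Module.End K X} {R : ι → Module.End K X}
    (hL : ∀ j, Commute L (R j)) (hR : ∀ i j, Commute (R i) (R j))
    (hinj : ∀ i j, i ≠ j → ∀ x, R i x = R j x → x = 0) {n : ι → ℕ} {x : ι → X}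
    (hx : ∀ j, ((L - R j) ^ n j) (x j) = 0) (hsum : ∑ j, x j = 0) (j : ι) : x j = 0 := by
  classical
  have hc : ∀ i j, Commute (L - R i) (L - R j) := fun i j =>
    ((Commute.refl L).sub_right (hL j)).sub_left ((hL i).symm.sub_right (hR i j))
  -- A generalized eigenvector for both `R j` and `R i` vanishes: the exponent of `L - R i` is
  -- lowered until `L y = R i y`, where the preceding lemma applies.
  have inj : ∀ i, i ≠ j → ∀ m y, ((L - R j) ^ n j) y = 0 → ((L - R i) ^ m) y = 0 → y = 0 := by
    intro i hij m
    induction m with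
    | zero => intro y _ hy; simpa using hy
    | succ m ih =>
      intro y hy hm
      have h1 : (L - R i) y = 0 := by
        refine ih _ ?_ (by rw [pow_succ] at hm; exact hm)
        have := LinearMap.congr_fun ((hc j i).pow_left (n j)).eq y
        simp only [Module.End.mul_apply, hy, map_zero] at this
        exact this
      exact eq_zero_of_sub_pow_apply_eq_zero (hL j) (hL i) (hR j i) (hinj j i hij.symm) hy
        (sub_eq_zero.1 h1)
  -- Applying `(L - R i) ^ n i` removes the term `i` and keeps the other terms generalized
  -- eigenvectors. Induction then gives that this power kills `x j`, and `inj` concludes.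
  have main : ∀ s : Finset ι, j ∉ s → ∀ x : ι → X, (∀ i, ((L - R i) ^ n i) (x i) = 0) →
      x j + ∑ i ∈ s, x i = 0 → x j = 0 := by
    intro s
    induction s using Finset.induction_on with
    | empty => intro _ x _ h; simpa using h
    | insert i s hi ih =>
      intro hj x hx h
      rw [Finset.mem_insert, not_or] at hj
      have hcomm : ∀ l, Commute ((L - R l) ^ n l) ((L - R i) ^ n i) := fun l =>
        (hc l i).pow_pow _ _
      have := ih hj.2 (fun l => ((L - R i) ^ n i) (x l)) (fun l => by
        have := LinearMap.congr_fun (hcomm l).eq (x l)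
        simp only [Module.End.mul_apply, hx l, map_zero] at this
        exact this) (by
        have := congrArg ((L - R i) ^ n i) h
        rwa [Finset.sum_insert hi, map_add, map_add, hx i, zero_add, map_sum, map_zero] at this)
      exact inj i (Ne.symm hj.1) _ _ (hx j) this
  refine main (Finset.univ.erase j) (by simp) x hx ?_
  rw [Finset.add_sum_erase _ _ (Finset.mem_univ j), hsum]

/-- `L - R` on functions `A → X`, where `L` multiplies the argument by `a` and `R` applies `T` to
the value. -/
def shiftOp {A : Type*} [CommRing A] (a : A) (T : Module.End K X) : Module.End K (A → X) :=
  LinearMap.funLeft K X (a * ·) - T.compLeft A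

theorem shiftOp_apply {A : Type*} [CommRing A] (a : A) (T : Module.End K X) (f : A → X) (b : A) :
    shiftOp a T f b = f (a * b) - T (f b) := rfl

/-- The shift operator commutes with multiplying the argument by `c`, as `A` is commutative, and
with any map intertwining `T` and `T'`. Later uses often take `G` to be the identity or `c = 1`. -/
theorem shiftOp_pow_comp {A Y : Type*} [CommRing A] [AddCommGroup Y] [Module K Y] (a : A)
    {T : Module.End K X} {T' : Module.End K Y} {G : X →ₗ[K] Y} (h : ∀ x, G (T x) = T' (G x))
    (n : ℕ) (f : A → X) (c : A) :
    (shiftOp a T' ^ n) (fun b => G (f (b * c))) = fun b => G ((shiftOp a T ^ n) f (b * c)) := by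
  induction n generalizing f with
  | zero => rfl
  | succ n ih =>
    rw [pow_succ, pow_succ, Module.End.mul_apply, Module.End.mul_apply, ← ih]
    congr 1
    funext b
    simp only [shiftOp_apply, map_sub, h, mul_assoc]

/-- A vector in a finite-dimensional subspace stable under `τ` vanishes, if the vectors `τ ^ n m`
are eigenvectors of `T` for distinct eigenvalues. -/
theorem eq_zero_of_eigenvectors {T τ : Module.End K X} (hτ : Function.Injective τ)
    {N : Submodule K X} [Module.Finite K N] (hN : ∀ x ∈ N, τ x ∈ N) {m : X} (hm : m ∈ N)
    {z : ℕ → K} (hz : Function.Injective z) (h : ∀ n, T ((τ ^ n) m) = z n • (τ ^ n) m) :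
    m = 0 := by
  by_contra hne
  have hmem : ∀ n, (τ ^ n) m ∈ N := fun n => by
    induction n with
    | zero => exact hm
    | succ n ih => rw [pow_succ', Module.End.mul_apply]; exact hN _ ih
  have hpow : ∀ n, (τ ^ n) m ≠ 0 := fun n => by
    induction n with
    | zero => exact hne
    | succ n ih =>
      rw [pow_succ', Module.End.mul_apply]
      exact fun h0 => ih (hτ (by rw [h0, map_zero]))
  have hli := T.eigenvectors_linearIndependent' z hz (fun n => (τ ^ n) m) fun n =>
    ⟨Module.End.mem_eigenspace_iff.2 (h n), hpow n⟩
  have hli' : LinearIndependent K (fun n => (⟨(τ ^ n) m, hmem n⟩ : N)) :=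
    LinearIndependent.of_comp N.subtype hli
  have := hli'.finite
  exact not_finite ℕ

/-- In the binomial expansion with exponent `m + n`, every term contains either at least `m` factors
`F i` or at least `n` factors of the remaining sum. -/
theorem sum_pow_apply_eq_zero {ι : Type*} (F : ι → Module.End K X) {s : Finset ι}
    (hc : ∀ i ∈ s, ∀ j ∈ s, Commute (F i) (F j)) {v : X} (h : ∀ i ∈ s, ∃ n, (F i ^ n) v = 0) :
    ∃ n, ((∑ i ∈ s, F i) ^ n) v = 0 := by
  classical
  induction s using Finset.induction_on with
  | empty => exact ⟨1, by simp⟩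
  | insert i s hi ih =>
    obtain ⟨n, hn⟩ := ih (fun i hi j hj => hc i (Finset.mem_insert_of_mem hi) j
      (Finset.mem_insert_of_mem hj)) fun i hi => h i (Finset.mem_insert_of_mem hi)
    obtain ⟨m, hm⟩ := h i (Finset.mem_insert_self _ _)
    have hcomm : Commute (F i) (∑ j ∈ s, F j) := Commute.sum_right _ _ _ fun j hj =>
      hc i (Finset.mem_insert_self _ _) j (Finset.mem_insert_of_mem hj)
    refine ⟨m + n, ?_⟩
    rw [Finset.sum_insert hi, hcomm.add_pow, LinearMap.sum_apply]
    refine Finset.sum_eq_zero fun k hk => ?_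
    rw [← (Nat.cast_commute _ _).eq, Module.End.mul_apply]
    suffices ((F i ^ k) * (∑ j ∈ s, F j) ^ (m + n - k)) v = 0 by rw [this, map_zero]
    by_cases hkm : m ≤ k
    · rw [(hcomm.pow_pow _ _).eq, Module.End.mul_apply, Module.End.pow_map_zero_of_le hkm hm,
        map_zero]
    · rw [Module.End.mul_apply, Module.End.pow_map_zero_of_le (by omega) hn, map_zero]

end LinearAlgebra

end WeylHom

end

noncomputable section

namespace WeylHom

variable {g : Type*} [LieRing g] [LieAlgebra ℂ g] [FiniteDimensional ℂ g]
  [LieAlgebra.IsSimple ℂ g] {H : LieSubalgebra ℂ g} [H.IsCartanSubalgebra]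

variable (b : (LieAlgebra.IsKilling.rootSystem H).Base)

/-! ### Generation of `𝔤` by `𝔫^+`, `𝔥` and the simple lowering vectors. -/

section Generation

open LieAlgebra LieAlgebra.IsKilling LieModule

/-- `𝔤_{-γ} ⊆ [𝔤_{-β}, 𝔤_{-α}]` for roots with `γ = α + β`. -/
theorem exists_lie_eq_of_mem_rootSpace_neg {α β γ : H.root}
    (h : (rootSystem H).root γ = (rootSystem H).root α + (rootSystem H).root β) {x : g}
    (hx : x ∈ rootSpace H (-(γ.1 : H → ℂ))) :
    ∃ f ∈ rootSpace H (-(β.1 : H → ℂ)), ∃ y ∈ rootSpace H (-(α.1 : H → ℂ)), x = ⁅f, y⁆ := by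
  have hβ : β.1.IsNonZero := LieSubalgebra.isNonZero_coe_root β
  have hγ : (-γ.1).IsNonZero := (LieSubalgebra.isNonZero_coe_root γ).neg
  have hsum : (γ.1 : H → ℂ) = α.1 + β.1 := by
    funext k
    exact LinearMap.congr_fun h k
  -- Since `-α = β - γ` is a root, the `β`-string through `-γ` continues at least one step above
  -- `-γ`.
  have hα : (-α.1 : Weight ℂ H g) = ((1 : ℤ) • (β.1 : H → ℂ) + ((-γ.1 : Weight ℂ H g) : H → ℂ)) := by
    rw [Weight.coe_neg, Weight.coe_neg, hsum]; module
  have htop : 1 ≤ chainTopCoeff β.1 (-γ.1) := by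
    have := ((rootSpace_zsmul_add_ne_bot_iff β.1 (-γ.1) hβ 1).1 (hα ▸ (-α.1).2)).1
    exact_mod_cast this
  obtain ⟨n, hn⟩ := Nat.exists_eq_add_of_le' htop
  obtain ⟨u, hu, u_ne⟩ := (chainTop β.1 (-γ.1)).exists_ne_zero
  obtain ⟨h, e, f, isSl2, he, hf⟩ := exists_isSl2Triple_of_weight_isNonZero hβ
  obtain rfl := isSl2.h_eq_coroot hβ he hf
  -- Descending from the top vector `u` of the string, `f ^ n u` has weight `-α` and `f ^ (n + 1) u`
  -- is a nonzero vector of weight `-γ`. As that root space is a line, `x` is a multiple of the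
  -- latter.
  have prim : isSl2.HasPrimitiveVectorWith u (chainLength β.1 (-γ.1) : ℂ) :=
    have := lie_mem_genWeightSpace_of_mem_genWeightSpace he hu
    ⟨u_ne, (chainLength_smul _ _ hu).symm, by rwa [genWeightSpace_add_chainTop _ _ hβ] at this⟩
  have hle : n + 1 ≤ chainLength β.1 (-γ.1) := hn ▸ chainTopCoeff_le_chainLength _ _
  have hne := prim.pow_toEnd_f_ne_zero_of_eq_nat rfl hle
  have hmem := toEnd_pow_apply_mem hf hu n
  have hmem' := toEnd_pow_apply_mem hf hu (n + 1)
  rw [coe_chainTop', hn] at hmem hmem'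
  have e1 : n • (-(β.1 : H → ℂ)) + ((n + 1) • (β.1 : H → ℂ) + ((-γ.1 : Weight ℂ H g) : H → ℂ)) =
      -(α.1 : H → ℂ) := by
    rw [Weight.coe_neg, hsum]; module
  have e2 : (n + 1) • (-(β.1 : H → ℂ)) +
      ((n + 1) • (β.1 : H → ℂ) + ((-γ.1 : Weight ℂ H g) : H → ℂ)) = -(γ.1 : H → ℂ) := by
    rw [Weight.coe_neg]; module
  rw [e1] at hmem
  rw [e2] at hmem'
  obtain ⟨c, hc⟩ := (finrank_eq_one_iff_of_nonzero'
    (⟨_, hmem'⟩ : rootSpace H (-(γ.1 : H → ℂ))) (by simpa using hne)).mp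
    (finrank_rootSpace_eq_one (-γ.1) hγ) ⟨x, hx⟩
  refine ⟨f, hf, c • _, Submodule.smul_mem _ c hmem, ?_⟩
  have := congrArg Subtype.val hc
  simp only [pow_succ', Module.End.mul_apply] at this
  rw [lie_smul]
  exact this.symm

/-- Only the negative root spaces need an argument: positive roots are built from simple ones by
successive addition, and the preceding lemma writes each new negative root vector as a bracket. -/
theorem eq_top_of_nPlus_le {Z : LieSubalgebra ℂ g} (hn : nPlus b ≤ Z.toSubmodule) (hH : H ≤ Z)
    (hf : ∀ i : b.support, ∀ y ∈ rootSpace H (-(i.1.1 : H → ℂ)), y ∈ Z) (x : g) : x ∈ Z := by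
  have hneg : ∀ i : H.root, b.IsPos i → ∀ y ∈ rootSpace H (-(i.1 : H → ℂ)), y ∈ Z := by
    intro i hi
    refine hi.induction_on_add (p := fun i => ∀ y ∈ rootSpace H (-(i.1 : H → ℂ)), y ∈ Z)
      (fun i hi => hf ⟨i, hi⟩) ?_
    intro i j k hk hi hj y hy
    obtain ⟨f, hf', z, hz, rfl⟩ := exists_lie_eq_of_mem_rootSpace_neg hk hy
    exact Z.lie_mem (hf ⟨j, hj⟩ _ hf') (hi _ hz)
  have hx : x ∈ ⨆ χ : Weight ℂ H g, genWeightSpace g χ := by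
    simp [iSup_genWeightSpace_eq_top' ℂ H g]
  induction hx using LieSubmodule.iSup_induction' with
  | zero => exact zero_mem _
  | add y z _ _ hy hz => exact add_mem hy hz
  | mem χ y hy =>
    by_cases hχ : χ.IsZero
    · rw [hχ.eq] at hy
      apply hH
      have := rootSpace_zero_eq ℂ g H
      rw [← LieSubalgebra.mem_toLieSubmodule, ← this]
      exact hy
    · let i : H.root := ⟨χ, by simpa using hχ⟩
      let := (rootSystem H).indexNeg
      rcases RootPairing.Base.IsPos.or_neg b i with hi | hi
      · exact hn (Submodule.mem_iSup_of_mem (⟨i, hi⟩ : {α : H.root // b.IsPos α}) hy)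
      · refine hneg _ hi y ?_
        have h1 : (rootSystem H).root ((rootSystem H).reflectionPerm i i) =
            -(rootSystem H).root i := by
          rw [RootPairing.root_reflectionPerm, RootPairing.reflection_apply_self]
        have : -((((rootSystem H).reflectionPerm i i).1 : Weight ℂ H g) : H → ℂ) = χ := by
          funext k
          exact neg_eq_iff_eq_neg.2 (LinearMap.congr_fun h1 k)
        rw [← this] at hy; exact hy

end Generation

theorem exists_sl2Triple_coroot (i : b.support) :
    ∃ e ∈ nPlus b, ∃ f ∈ LieAlgebra.rootSpace H (-(i.1.1 : H → ℂ)),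
      IsSl2Triple (LieAlgebra.IsKilling.coroot i.1.1 : g) e f ∧
      ∀ y ∈ LieAlgebra.rootSpace H (-(i.1.1 : H → ℂ)), ∃ c : ℂ, y = c • f := by
  have hα : i.1.1.IsNonZero := LieSubalgebra.isNonZero_coe_root i.1
  obtain ⟨h, e, f, ht, he, hf⟩ := LieAlgebra.IsKilling.exists_isSl2Triple_of_weight_isNonZero hα
  obtain rfl := ht.h_eq_coroot hα he hf
  refine ⟨e, ?_, f, hf, ht, fun y hy => ?_⟩
  · exact Submodule.mem_iSup_of_mem (⟨i.1, b.isPos_of_mem_support i.2⟩ : {α // b.IsPos α}) he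
  · obtain ⟨c, hc⟩ := (finrank_eq_one_iff_of_nonzero'
      (⟨f, hf⟩ : LieAlgebra.rootSpace H (-(i.1.1 : H → ℂ)))
      (by simpa using ht.f_ne_zero)).mp
      (LieAlgebra.IsKilling.finrank_rootSpace_eq_one (-i.1.1) (by simpa using hα)) ⟨y, hy⟩
    exact ⟨c, by simpa using congrArg Subtype.val hc.symm⟩

theorem fundWeight_coroot [DecidableEq b.support] (i j : b.support) :
    fundWeight b i (LieAlgebra.IsKilling.coroot j.1.1) = if j = i then 1 else 0 := by
  have h : b.toCoweightBasis j = LieAlgebra.IsKilling.coroot j.1.1 := b.toCoweightBasis_apply j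
  rw [fundWeight, ← h, Module.Basis.coord_apply, Module.Basis.repr_self, Finsupp.single_apply]

theorem sum_fundWeight_smul_coroot (h : H) :
    ∑ j : b.support, fundWeight b j h • LieAlgebra.IsKilling.coroot j.1.1 = h := by
  have := b.toCoweightBasis.sum_repr h
  simpa [fundWeight] using this

variable {A : Type*} [CommRing A] [Algebra ℂ A]

omit [FiniteDimensional ℂ g] [LieAlgebra.IsSimple ℂ g] in
theorem current_lie (c d : A) (x y : g) :
    ⁅c ⊗ₜ[ℂ] x, d ⊗ₜ[ℂ] y⁆ = (c * d) ⊗ₜ[ℂ] ⁅x, y⁆ :=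
  LieAlgebra.ExtendScalars.bracket_tmul ..

/-! ### Shift operators and the action of the current algebra. -/

section CurrentModule

variable {M : Type*} [AddCommGroup M] [Module ℂ M] [LieRingModule (A ⊗[ℂ] g) M]
  [LieModule ℂ (A ⊗[ℂ] g) M]

omit [FiniteDimensional ℂ g] [LieAlgebra.IsSimple ℂ g] [Module ℂ M]
  [LieModule ℂ (A ⊗[ℂ] g) M] in
theorem lie_lie_current (c d : A) (x y : g) (m : M) :
    ⁅c ⊗ₜ[ℂ] x, ⁅d ⊗ₜ[ℂ] y, m⁆⁆ =
      ⁅(c * d) ⊗ₜ[ℂ] ⁅x, y⁆, m⁆ + ⁅d ⊗ₜ[ℂ] y, ⁅c ⊗ₜ[ℂ] x, m⁆⁆ := by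
  rw [leibniz_lie, current_lie]

variable {T : Module.End ℂ M} (hT : ∀ (x : A ⊗[ℂ] g) m, T ⁅x, m⁆ = ⁅x, T m⁆) (a : A)
include hT

omit [FiniteDimensional ℂ g] [LieAlgebra.IsSimple ℂ g] in
-- Expand `(dc ⊗ [x, y]) m` as a commutator of `c ⊗ x` and `d ⊗ y`. The `q`-th power of the shift in
-- `d` kills the term where `d ⊗ y` acts first; at `d = 1` the other term becomes `-G ((c ⊗ x) m)`,
-- with `G` commuting with `T`. The `p`-th power in `c` kills that.
theorem shiftOp_pow_lie {x y : g} {m : M} {p q : ℕ}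
    (hx : (shiftOp a T ^ p) (fun c : A => ⁅c ⊗ₜ[ℂ] x, m⁆) = 0)
    (hy : (shiftOp a T ^ q) (fun c : A => ⁅c ⊗ₜ[ℂ] y, m⁆) = 0) :
    (shiftOp a T ^ (p + q)) (fun c : A => ⁅c ⊗ₜ[ℂ] ⁅x, y⁆, m⁆) = 0 := by
  let Y : M →ₗ[ℂ] A → M := LinearMap.pi fun c => LieModule.toEnd ℂ (A ⊗[ℂ] g) M (c ⊗ₜ y)
  let G : Module.End ℂ M := LinearMap.proj 1 ∘ₗ (shiftOp a T ^ q) ∘ₗ Y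
  have hG : ∀ u, G (T u) = T (G u) := by
    intro u
    have := congrFun (shiftOp_pow_comp a (G := T) (T := T) (T' := T) (fun _ => rfl) q (Y u) 1) 1
    simp only [mul_one] at this
    refine Eq.trans ?_ this
    change (shiftOp a T ^ q) (Y (T u)) 1 = _
    exact congrFun (congrArg (shiftOp a T ^ q) (funext fun c => (hT _ _).symm)) 1
  have h1 : (shiftOp a T ^ q) (fun c : A => ⁅c ⊗ₜ[ℂ] ⁅x, y⁆, m⁆) =
      fun c => -G ⁅c ⊗ₜ[ℂ] x, m⁆ := by
    funext c
    have e1 := congrFun (shiftOp_pow_comp a (G := LinearMap.id) (T := T) (T' := T) (fun _ => rfl) q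
      (fun c : A => ⁅c ⊗ₜ[ℂ] ⁅x, y⁆, m⁆) c) 1
    have e2 := congrFun (shiftOp_pow_comp a (T := T) (T' := T)
      (G := LieModule.toEnd ℂ (A ⊗[ℂ] g) M (c ⊗ₜ x)) (fun u => (hT _ u).symm) q
      (fun c : A => ⁅c ⊗ₜ[ℂ] y, m⁆) 1) 1
    simp only [one_mul, LinearMap.id_apply] at e1
    rw [hy] at e2
    rw [← e1]
    have e3 : (fun d : A => ⁅(d * c) ⊗ₜ[ℂ] ⁅x, y⁆, m⁆) =
        (fun d : A => LieModule.toEnd ℂ (A ⊗[ℂ] g) M (c ⊗ₜ x) ⁅(d * 1) ⊗ₜ[ℂ] y, m⁆) -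
          Y ⁅c ⊗ₜ[ℂ] x, m⁆ := by
      funext d
      simp only [Pi.sub_apply, LieModule.toEnd_apply_apply, mul_one, Y, LinearMap.pi_apply]
      rw [lie_lie_current, mul_comm, add_sub_cancel_right]
    rw [e3, map_sub, Pi.sub_apply, e2]
    simp [G]
  have h2 := shiftOp_pow_comp a (T := T) (T' := T) (G := -G) (fun u => by simp [hG]) p
      (fun c : A => ⁅c ⊗ₜ[ℂ] x, m⁆) 1
  rw [pow_add, Module.End.mul_apply, h1]
  simp only [mul_one] at h2
  refine h2.trans ?_
  rw [hx]
  funext c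
  simp

omit [FiniteDimensional ℂ g] [LieAlgebra.IsSimple ℂ g] in
-- Commuting `c ⊗ x` past `d ⊗ y` leaves two terms, both killed by the same power `n`. That the
-- exponent does not grow makes it uniform over a cyclic module.
theorem shiftOp_pow_lie_apply {n : ℕ} {m : M}
    (h : ∀ x : g, (shiftOp a T ^ n) (fun c : A => ⁅c ⊗ₜ[ℂ] x, m⁆) = 0) (d : A) (x y : g) :
    (shiftOp a T ^ n) (fun c : A => ⁅c ⊗ₜ[ℂ] x, ⁅d ⊗ₜ[ℂ] y, m⁆⁆) = 0 := by
  have e1 := shiftOp_pow_comp a (G := LinearMap.id) (T := T) (T' := T) (fun _ => rfl) n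
    (fun c : A => ⁅c ⊗ₜ[ℂ] ⁅x, y⁆, m⁆) d
  have e2 := shiftOp_pow_comp a (T := T) (T' := T)
    (G := LieModule.toEnd ℂ (A ⊗[ℂ] g) M (d ⊗ₜ y)) (fun u => (hT _ u).symm) n
    (fun c : A => ⁅c ⊗ₜ[ℂ] x, m⁆) 1
  rw [h] at e1 e2
  have e3 : (fun c : A => ⁅c ⊗ₜ[ℂ] x, ⁅d ⊗ₜ[ℂ] y, m⁆⁆) =
      (fun c : A => LinearMap.id (R := ℂ) ⁅(c * d) ⊗ₜ[ℂ] ⁅x, y⁆, m⁆) +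
        fun c : A => LieModule.toEnd ℂ (A ⊗[ℂ] g) M (d ⊗ₜ y) ⁅(c * 1) ⊗ₜ[ℂ] x, m⁆ := by
    funext c
    simp only [Pi.add_apply, LieModule.toEnd_apply_apply, mul_one, LinearMap.id_apply]
    rw [lie_lie_current]
  rw [e3, map_add, e1, e2]
  funext c
  simp

end CurrentModule

/-! ### Global Weyl modules as cyclic modules. -/

section Weyl

variable {b} {lam : Module.Dual ℂ H}

theorem lie_wgen (c : A) (x : g) : ⁅c ⊗ₜ[ℂ] x, wgen b A lam⁆ = cur c x • wgen b A lam := rfl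

theorem smul_wgen_eq_zero {u : UA A g} (hu : u ∈ weylRelations b A lam) :
    u • wgen b A lam = 0 := by
  change Submodule.Quotient.mk (u * 1) = _
  rw [mul_one]
  exact (Submodule.Quotient.mk_eq_zero _).2 (Submodule.subset_span hu)

theorem nPlus_lie_wgen (c : A) {x : g} (hx : x ∈ nPlus b) : ⁅c ⊗ₜ[ℂ] x, wgen b A lam⁆ = 0 :=
  smul_wgen_eq_zero (Or.inl (Or.inl ⟨c, x, hx, rfl⟩))

theorem cartan_lie_wgen (h : H) :
    ⁅(1 : A) ⊗ₜ[ℂ] (h : g), wgen b A lam⁆ = lam h • wgen b A lam := by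
  have := smul_wgen_eq_zero (b := b) (A := A) (lam := lam) (Or.inl (Or.inr ⟨h, rfl⟩))
  rw [sub_smul, sub_eq_zero, algebraMap_smul] at this
  exact this

theorem pow_lie_wgen {i : b.support} {y : g}
    (hy : y ∈ LieAlgebra.rootSpace H (-(i.1.1 : H → ℂ))) {n : ℕ}
    (hn : lam (LieAlgebra.IsKilling.coroot i.1.1) = n) :
    (LieModule.toEnd ℂ (A ⊗[ℂ] g) _ ((1 : A) ⊗ₜ[ℂ] y) ^ (n + 1)) (wgen b A lam) = 0 := by
  have h1 : ∀ k, (LieModule.toEnd ℂ (A ⊗[ℂ] g) _ ((1 : A) ⊗ₜ[ℂ] y) ^ k) (wgen b A lam) =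
      (cur 1 y : UA A g) ^ k • wgen b A lam := by
    intro k
    induction k with
    | zero => simp
    | succ k ih =>
      rw [pow_succ', Module.End.mul_apply, ih, pow_succ', mul_smul]; rfl
  rw [h1]
  exact smul_wgen_eq_zero (Or.inr ⟨i, y, hy, n, hn, rfl⟩)

theorem weyl_induction {C : GlobalWeyl b A lam → Prop} (hw : C (wgen b A lam))
    (hadd : ∀ m m', C m → C m' → C (m + m')) (hsmul : ∀ (c : ℂ) m, C m → C (c • m))
    (hlie : ∀ (c : A) (x : g) m, C m → C ⁅c ⊗ₜ[ℂ] x, m⁆) (m : GlobalWeyl b A lam) : C m := by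
  obtain ⟨u, rfl⟩ := exists_smul_wgen b lam m
  suffices ∀ m, C m → C (u • m) from this _ hw
  refine ind_cur (C := fun u => ∀ m, C m → C (u • m)) ?_ ?_ ?_ ?_ u
  · intro c m hm
    rw [algebraMap_smul]; exact hsmul c m hm
  · intro c x m hm
    exact hlie c x m hm
  · intro u v hu hv m hm
    rw [mul_smul]; exact hu _ (hv _ hm)
  · intro u v hu hv m hm
    rw [add_smul]; exact hadd _ _ (hu _ hm) (hv _ hm)

theorem rightActHom_lie (p : UA A H) (x : A ⊗[ℂ] g) (m : GlobalWeyl b A lam) :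
    rightActHom b lam p ⁅x, m⁆ = ⁅x, rightActHom b lam p m⁆ :=
  map_smul (rightAct b lam p) _ _

theorem rightActHom_wgen (c : A) (h : H) :
    rightActHom b lam (cur c h) (wgen b A lam) = ⁅c ⊗ₜ[ℂ] (h : g), wgen b A lam⁆ := by
  rw [lie_wgen, ← cartanMap_cur]
  exact rightAct_wgen b lam _

theorem end_ext_weyl {S T : Module.End ℂ (GlobalWeyl b A lam)}
    (hS : ∀ (x : A ⊗[ℂ] g) m, S ⁅x, m⁆ = ⁅x, S m⁆) (hT : ∀ (x : A ⊗[ℂ] g) m, T ⁅x, m⁆ = ⁅x, T m⁆)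
    (h : S (wgen b A lam) = T (wgen b A lam)) : S = T := by
  ext m
  induction m using weyl_induction with
  | hw => exact h
  | hadd m m' hm hm' => simp [hm, hm']
  | hsmul c m hm => simp [hm]
  | hlie c x m hm => rw [hS, hT, hm]

end Weyl

end WeylHom

end

noncomputable section

namespace WeylHom

/-! ### Locally finite operators. -/

section LocallyFinite

variable {K X Y Z : Type*} [Field K] [AddCommGroup X] [Module K X] [AddCommGroup Y] [Module K Y]
  [AddCommGroup Z] [Module K Z]

/-- `x` lies in a finite-dimensional subspace stable under `τ`. -/
def IsLocallyFinite (τ : Module.End K X) (x : X) : Prop :=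
  ∃ N : Submodule K X, N.FG ∧ x ∈ N ∧ ∀ y ∈ N, τ y ∈ N

theorem IsLocallyFinite.of_smul {τ : Module.End K X} {x : X} {c : K} (h : τ x = c • x) :
    IsLocallyFinite τ x := by
  refine ⟨K ∙ x, Submodule.fg_span_singleton x, Submodule.mem_span_singleton_self x,
    fun y hy => ?_⟩
  obtain ⟨d, rfl⟩ := Submodule.mem_span_singleton.1 hy
  rw [map_smul, h]
  exact Submodule.smul_mem _ _ (Submodule.smul_mem _ _ (Submodule.mem_span_singleton_self x))

theorem IsLocallyFinite.add {τ : Module.End K X} {x y : X} (hx : IsLocallyFinite τ x)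
    (hy : IsLocallyFinite τ y) : IsLocallyFinite τ (x + y) := by
  obtain ⟨N, hN, hx, hτ⟩ := hx
  obtain ⟨N', hN', hy, hτ'⟩ := hy
  refine ⟨N ⊔ N', hN.sup hN', Submodule.add_mem_sup hx hy, fun z hz => ?_⟩
  obtain ⟨u, hu, v, hv, rfl⟩ := Submodule.mem_sup.1 hz
  rw [map_add]
  exact Submodule.add_mem_sup (hτ _ hu) (hτ' _ hv)

theorem IsLocallyFinite.smul {τ : Module.End K X} {x : X} (hx : IsLocallyFinite τ x) (c : K) :
    IsLocallyFinite τ (c • x) := by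
  obtain ⟨N, hN, hx, hτ⟩ := hx
  exact ⟨N, hN, N.smul_mem c hx, hτ⟩

theorem IsLocallyFinite.map₂ {τ : Module.End K X} {τ' : Module.End K Y} {τ'' : Module.End K Z}
    (f : X →ₗ[K] Y →ₗ[K] Z) (hf : ∀ x y, τ'' (f x y) = f (τ x) (τ' y)) {x : X} {y : Y}
    (hx : IsLocallyFinite τ x) (hy : IsLocallyFinite τ' y) : IsLocallyFinite τ'' (f x y) := by
  obtain ⟨N, hN, hx, hτ⟩ := hx
  obtain ⟨N', hN', hy, hτ'⟩ := hy
  refine ⟨Submodule.map₂ f N N', hN.map₂ f hN', Submodule.apply_mem_map₂ f hx hy, ?_⟩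
  suffices Submodule.map₂ f N N' ≤ (Submodule.map₂ f N N').comap τ'' from this
  refine Submodule.map₂_le.2 fun u hu v hv => ?_
  rw [Submodule.mem_comap, hf]
  exact Submodule.apply_mem_map₂ f (hτ _ hu) (hτ' _ hv)

end LocallyFinite

/-! ### Rescalings and translations of the variables. -/

section LaurentPoly

variable {k l : ℕ}

/-- Rescaling the invertible variable `i` of a Laurent polynomial ring by the unit `c`. -/
def scaleHom (i : Fin k) (c : ℂˣ) : LaurentPoly k l →ₐ[ℂ] LaurentPoly k l :=
  AddMonoidAlgebra.lift ℂ _ _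
    { toFun := fun p => AddMonoidAlgebra.single p.toAdd ((c ^ p.toAdd.1 i : ℂˣ) : ℂ)
      map_one' := by simp [AddMonoidAlgebra.one_def]
      map_mul' := fun p q => by
        rw [AddMonoidAlgebra.single_mul_single]
        simp [zpow_add] }

theorem scaleHom_single (i : Fin k) (c : ℂˣ) (p : (Fin k → ℤ) × (Fin l → ℕ)) :
    scaleHom i c (AddMonoidAlgebra.single p 1) =
      ((c ^ p.1 i : ℂˣ) : ℂ) • AddMonoidAlgebra.single p 1 := by
  rw [scaleHom, AddMonoidAlgebra.lift_single]
  simp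

theorem scaleHom_scaleHom_inv (i : Fin k) (c : ℂˣ) (x : LaurentPoly k l) :
    scaleHom i c (scaleHom i c⁻¹ x) = x := by
  induction x using AddMonoidAlgebra.induction_on with
  | of p =>
    rw [AddMonoidAlgebra.of_apply, scaleHom_single, map_smul, scaleHom_single, smul_smul,
      ← Units.val_mul, inv_zpow, inv_mul_cancel, Units.val_one, one_smul]
  | add x y hx hy => rw [map_add, map_add, hx, hy]
  | smul r x hx => rw [map_smul, map_smul, hx]

theorem isLocallyFinite_scaleHom (i : Fin k) (c : ℂˣ) (x : LaurentPoly k l) :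
    IsLocallyFinite (scaleHom i c).toLinearMap x := by
  induction x using AddMonoidAlgebra.induction_on with
  | of p => exact IsLocallyFinite.of_smul (scaleHom_single i c p)
  | add x y hx hy => exact hx.add hy
  | smul r x hx => exact hx.smul r

/-- The variable `u_i` of a Laurent polynomial ring. -/
def polyVar (i : Fin l) : LaurentPoly k l := AddMonoidAlgebra.single (0, Pi.single i 1) 1

/-- Translating the variable `u_i` of a Laurent polynomial ring by `c`. -/
def translateHom (i : Fin l) (c : ℂ) : LaurentPoly k l →ₐ[ℂ] LaurentPoly k l :=
  AddMonoidAlgebra.lift ℂ _ _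
    { toFun := fun p => AddMonoidAlgebra.single (p.toAdd.1, Function.update p.toAdd.2 i 0) 1 *
        (polyVar i + algebraMap ℂ _ c) ^ p.toAdd.2 i
      map_one' := by simp [AddMonoidAlgebra.one_def]; rfl
      map_mul' := fun p q => by
        have : (AddMonoidAlgebra.single ((p * q).toAdd.1, Function.update (p * q).toAdd.2 i 0) 1 :
            LaurentPoly k l) =
            AddMonoidAlgebra.single (p.toAdd.1, Function.update p.toAdd.2 i 0) 1 *
            AddMonoidAlgebra.single (q.toAdd.1, Function.update q.toAdd.2 i 0) 1 := by
          rw [AddMonoidAlgebra.single_mul_single, mul_one]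
          congr 1
          refine Prod.ext rfl ?_
          simp [← Function.update_add]
        rw [this]
        simp only [toAdd_mul, Prod.snd_add, Pi.add_apply, pow_add]
        ring }

theorem translateHom_single (i : Fin l) (c : ℂ) (p : (Fin k → ℤ) × (Fin l → ℕ)) :
    translateHom i c (AddMonoidAlgebra.single p 1) =
      AddMonoidAlgebra.single (p.1, Function.update p.2 i 0) 1 *
        (polyVar i + algebraMap ℂ _ c) ^ p.2 i := by
  rw [translateHom, AddMonoidAlgebra.lift_single]
  simp

theorem translateHom_polyVar (i : Fin l) (c : ℂ) :
    translateHom (k := k) i c (polyVar i) = polyVar i + algebraMap ℂ _ c := by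
  rw [polyVar, translateHom_single]
  have : ((0, Function.update (Pi.single i 1) i 0) : (Fin k → ℤ) × (Fin l → ℕ)) = 0 := by
    simp [Pi.single]
  simp only [this, Pi.single_eq_same, pow_one]
  rw [← AddMonoidAlgebra.one_def, one_mul]; rfl

theorem translateHom_single_of_eq_zero (i : Fin l) (c : ℂ) {p : (Fin k → ℤ) × (Fin l → ℕ)}
    (hp : p.2 i = 0) :
    translateHom i c (AddMonoidAlgebra.single p 1) = AddMonoidAlgebra.single p 1 := by
  rw [translateHom_single, hp, pow_zero, mul_one, Function.update_eq_self_iff.2 hp.symm]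

theorem single_eq_mul_polyVar_pow (i : Fin l) (p : (Fin k → ℤ) × (Fin l → ℕ)) :
    (AddMonoidAlgebra.single p 1 : LaurentPoly k l) =
      AddMonoidAlgebra.single (p.1, Function.update p.2 i 0) 1 * polyVar i ^ p.2 i := by
  rw [polyVar, AddMonoidAlgebra.single_pow, AddMonoidAlgebra.single_mul_single]
  simp only [one_pow, mul_one]
  congr 1
  refine Prod.ext (by simp) ?_
  funext j
  by_cases h : j = i
  · subst h; simp
  · simp [h]

theorem translateHom_translateHom_neg (i : Fin l) (c : ℂ) (x : LaurentPoly k l) :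
    translateHom i c (translateHom i (-c) x) = x := by
  induction x using AddMonoidAlgebra.induction_on with
  | of p =>
    rw [AddMonoidAlgebra.of_apply, translateHom_single, map_mul, map_pow, map_add,
      AlgHom.commutes, translateHom_polyVar, translateHom_single_of_eq_zero _ _ (by simp),
      map_neg, add_neg_cancel_right, ← single_eq_mul_polyVar_pow]
  | add x y hx hy => rw [map_add, map_add, hx, hy]
  | smul r x hx => rw [map_smul, map_smul, hx]

/-- Locally finite elements are closed under products because `translateHom i c` is multiplicative.
A monomial is a fixed monomial times a power of `u_i`, and `u_i` lies in the stable span of `u_i`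
and `1`. -/
theorem isLocallyFinite_translateHom (i : Fin l) (c : ℂ) (x : LaurentPoly k l) :
    IsLocallyFinite (translateHom i c).toLinearMap x := by
  have hone : IsLocallyFinite (translateHom (k := k) i c).toLinearMap 1 :=
    IsLocallyFinite.of_smul (c := 1) (by simp)
  have hmul : ∀ {x y : LaurentPoly k l}, IsLocallyFinite (translateHom i c).toLinearMap x →
      IsLocallyFinite (translateHom i c).toLinearMap y →
      IsLocallyFinite (translateHom i c).toLinearMap (x * y) := fun hx hy =>
    IsLocallyFinite.map₂ (LinearMap.mul ℂ (LaurentPoly k l)) (fun x y => by simp) hx hy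
  have hu : IsLocallyFinite (translateHom (k := k) i c).toLinearMap (polyVar i) := by
    refine ⟨Submodule.span ℂ {polyVar i, 1}, Submodule.fg_span (by simp),
      Submodule.subset_span (by simp), ?_⟩
    suffices Submodule.span ℂ {polyVar i, 1} ≤
      (Submodule.span ℂ {polyVar i, 1}).comap (translateHom (k := k) i c).toLinearMap from this
    rw [Submodule.span_le, Set.insert_subset_iff, Set.singleton_subset_iff]
    simp only [SetLike.mem_coe, Submodule.mem_comap, AlgHom.toLinearMap_apply]
    constructor
    · rw [translateHom_polyVar, Algebra.algebraMap_eq_smul_one]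
      exact add_mem (Submodule.subset_span (by simp))
        (Submodule.smul_mem _ _ (Submodule.subset_span (by simp)))
    · rw [map_one]
      exact Submodule.subset_span (by simp)
  induction x using AddMonoidAlgebra.induction_on with
  | of p =>
    rw [AddMonoidAlgebra.of_apply, toAdd_ofAdd, single_eq_mul_polyVar_pow i]
    refine hmul (IsLocallyFinite.of_smul (c := 1) ?_) ?_
    · rw [one_smul]
      exact translateHom_single_of_eq_zero i c (by simp)
    · induction p.2 i with
      | zero => rw [pow_zero]; exact hone
      | succ n ih => rw [pow_succ]; exact hmul ih hu
  | add x y hx hy => exact hx.add hy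
  | smul r x hx => exact hx.smul r

end LaurentPoly

variable {g : Type*} [LieRing g] [LieAlgebra ℂ g] [FiniteDimensional ℂ g]
  [LieAlgebra.IsSimple ℂ g] {H : LieSubalgebra ℂ g} [H.IsCartanSubalgebra]

variable {b : (LieAlgebra.IsKilling.rootSystem H).Base}

variable {A : Type*} [CommRing A] [Algebra ℂ A]

/-! ### Functoriality of the global Weyl module in `A`. -/

section Functoriality

attribute [local instance 100] LieRing.ofAssociativeRing

variable {lam : Module.Dual ℂ H}

/-- The Lie algebra homomorphism `𝔤 ⊗ A → 𝔤 ⊗ A` induced by an endomorphism of `A`. -/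
def currentMap (g : Type*) [LieRing g] [LieAlgebra ℂ g] (σ : A →ₐ[ℂ] A) :
    A ⊗[ℂ] g →ₗ⁅ℂ⁆ A ⊗[ℂ] g :=
  { LinearMap.rTensor g σ.toLinearMap with
    map_lie' := by
      intro x y
      induction x using TensorProduct.induction_on with
      | zero => simp
      | add x x' hx hx' => simp_all [add_lie]
      | tmul c x =>
        induction y using TensorProduct.induction_on with
        | zero => simp
        | add y y' hy hy' => simp_all [lie_add]
        | tmul d y => simp [LieAlgebra.ExtendScalars.bracket_tmul] }

/-- The endomorphism of `U(𝔤 ⊗ A)` induced by an endomorphism of `A`. -/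
def ueaMap (g : Type*) [LieRing g] [LieAlgebra ℂ g] (σ : A →ₐ[ℂ] A) : UA A g →ₐ[ℂ] UA A g :=
  UniversalEnvelopingAlgebra.lift ℂ ((UniversalEnvelopingAlgebra.ι ℂ).comp (currentMap g σ))

omit [FiniteDimensional ℂ g] [LieAlgebra.IsSimple ℂ g] in
theorem ueaMap_cur (σ : A →ₐ[ℂ] A) (c : A) (x : g) : ueaMap g σ (cur c x) = cur (σ c) x := by
  rw [ueaMap, cur, UniversalEnvelopingAlgebra.lift_ι_apply]
  rfl

/-- The relations involve `A` only through arbitrary coefficients on `𝔫^+` and through the unit, so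
`σ` maps relations to relations. -/
theorem ueaMap_mem_weylIdeal (σ : A →ₐ[ℂ] A) {u : UA A g} (hu : u ∈ weylIdeal b A lam) :
    ueaMap g σ u ∈ weylIdeal b A lam := by
  induction hu using Submodule.span_induction with
  | mem u hu =>
    refine Submodule.subset_span ?_
    rcases hu with (⟨c, x, hx, rfl⟩ | ⟨h, rfl⟩) | ⟨i, y, hy, n, hn, rfl⟩
    · exact Or.inl (Or.inl ⟨σ c, x, hx, ueaMap_cur σ c x⟩)
    · exact Or.inl (Or.inr ⟨h, by rw [map_sub, ueaMap_cur, map_one, AlgHom.commutes]⟩)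
    · exact Or.inr ⟨i, y, hy, n, hn, by rw [map_pow, ueaMap_cur, map_one]⟩
  | zero => simp
  | add u v _ _ hu hv => rw [map_add]; exact add_mem hu hv
  | smul r u _ hu => rw [smul_eq_mul, map_mul]; exact Submodule.smul_mem _ _ hu

/-- The endomorphism of a global Weyl module induced by an endomorphism of `A`. -/
def weylMap (b : (LieAlgebra.IsKilling.rootSystem H).Base) (lam : Module.Dual ℂ H)
    (σ : A →ₐ[ℂ] A) : Module.End ℂ (GlobalWeyl b A lam) :=
  let f : UA A g →ₛₗ[(ueaMap g σ : UA A g →+* UA A g)] UA A g :=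
    { toFun := ueaMap g σ
      map_add' := map_add _
      map_smul' := fun u v => map_mul _ u v }
  let F : GlobalWeyl b A lam →ₛₗ[(ueaMap g σ : UA A g →+* UA A g)] GlobalWeyl b A lam :=
    Submodule.mapQ (weylIdeal b A lam) (weylIdeal b A lam) f
      fun _ hu => ueaMap_mem_weylIdeal σ hu
  { toFun := F
    map_add' := map_add F
    map_smul' := fun c m => by
      have h1 : ∀ m : GlobalWeyl b A lam, c • m = algebraMap ℂ (UA A g) c • m := fun m =>
        (algebraMap_smul _ c m).symm
      rw [RingHom.id_apply, h1 m, h1]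
      refine (F.map_smulₛₗ (algebraMap ℂ (UA A g) c) m).trans ?_
      congr 1
      exact AlgHom.commutes _ _ }

theorem weylMap_smul (σ : A →ₐ[ℂ] A) (u : UA A g) (m : GlobalWeyl b A lam) :
    weylMap b lam σ (u • m) = ueaMap g σ u • weylMap b lam σ m := by
  obtain ⟨v, rfl⟩ := Submodule.Quotient.mk_surjective _ m
  change Submodule.Quotient.mk (ueaMap g σ (u * v)) =
    Submodule.Quotient.mk (ueaMap g σ u * ueaMap g σ v)
  rw [map_mul]

theorem weylMap_lie (σ : A →ₐ[ℂ] A) (c : A) (x : g) (m : GlobalWeyl b A lam) :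
    weylMap b lam σ ⁅c ⊗ₜ[ℂ] x, m⁆ = ⁅σ c ⊗ₜ[ℂ] x, weylMap b lam σ m⁆ := by
  have := weylMap_smul σ (cur c x) m
  rwa [ueaMap_cur] at this

theorem weylMap_wgen (σ : A →ₐ[ℂ] A) : weylMap b lam σ (wgen b A lam) = wgen b A lam := by
  change Submodule.Quotient.mk (ueaMap g σ 1) = Submodule.Quotient.mk 1
  rw [map_one]

theorem weylMap_comp_eq_id {σ σ' : A →ₐ[ℂ] A} (h : ∀ c, σ (σ' c) = c) (m : GlobalWeyl b A lam) :
    weylMap b lam σ (weylMap b lam σ' m) = m := by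
  induction m using weyl_induction with
  | hw => rw [weylMap_wgen, weylMap_wgen]
  | hadd m m' hm hm' => rw [map_add, map_add, hm, hm']
  | hsmul c m hm => rw [map_smul, map_smul, hm]
  | hlie c x m hm => rw [weylMap_lie, weylMap_lie, hm, h]

/-- The generator is fixed, and the action `(c, m) ↦ (c ⊗ x) m` is an equivariant bilinear map, so
local finiteness passes from `A` to the module. -/
theorem isLocallyFinite_weylMap {σ : A →ₐ[ℂ] A} (h : ∀ c, IsLocallyFinite σ.toLinearMap c)
    (m : GlobalWeyl b A lam) : IsLocallyFinite (weylMap b lam σ) m := by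
  induction m using weyl_induction with
  | hw => exact IsLocallyFinite.of_smul (c := 1) (by rw [weylMap_wgen, one_smul])
  | hadd m m' hm hm' => exact hm.add hm'
  | hsmul c m hm => exact hm.smul c
  | hlie c x m hm =>
    exact IsLocallyFinite.map₂ (τ := σ.toLinearMap) (τ' := weylMap b lam σ)
      ((LieModule.toEnd ℂ (A ⊗[ℂ] g) (GlobalWeyl b A lam)).toLinearMap ∘ₗ
        (TensorProduct.mk ℂ A g).flip x) (fun c m => weylMap_lie σ c x m) (h c) hm

theorem weylMap_rightActHom (σ : A →ₐ[ℂ] A) (c : A) (h : H) (m : GlobalWeyl b A lam) :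
    weylMap b lam σ (rightActHom b lam (cur c h) m) =
      rightActHom b lam (cur (σ c) h) (weylMap b lam σ m) := by
  induction m using weyl_induction with
  | hw => rw [weylMap_wgen, rightActHom_wgen, rightActHom_wgen, weylMap_lie, weylMap_wgen]
  | hadd m m' hm hm' => simp only [map_add, hm, hm']
  | hsmul c m hm => simp only [map_smul, hm]
  | hlie c x m hm => rw [rightActHom_lie, weylMap_lie, weylMap_lie, rightActHom_lie, hm]

end Functoriality

end WeylHom

end

noncomputable section

namespace WeylHom

variable {g : Type*} [LieRing g] [LieAlgebra ℂ g] [FiniteDimensional ℂ g]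
  [LieAlgebra.IsSimple ℂ g] {H : LieSubalgebra ℂ g} [H.IsCartanSubalgebra]

variable {b : (LieAlgebra.IsKilling.rootSystem H).Base}

variable {A : Type*} [CommRing A] [Algebra ℂ A]

/-! ### The fundamental Weyl modules `W_A(ω_i)`. -/

section FundamentalWeyl

variable (i : b.support)

/-- As `ω_i(h_j) = 0`, the vector `f_j ⊗ 1` kills the generator. Applying `e_j ⊗ c` yields the claim
for `h_j ⊗ c`, and then applying `h_j ⊗ c` yields it for `f_j ⊗ c`. -/
theorem lie_wgen_fundWeight_of_ne {j : b.support} (h : j ≠ i) {f : g}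
    (hf : f ∈ LieAlgebra.rootSpace H (-(j.1.1 : H → ℂ))) (c : A) :
    ⁅c ⊗ₜ[ℂ] (LieAlgebra.IsKilling.coroot j.1.1 : g), wgen b A (fundWeight b i)⁆ = 0 ∧
      ⁅c ⊗ₜ[ℂ] f, wgen b A (fundWeight b i)⁆ = 0 := by
  classical
  obtain ⟨e, he, f', hf', ht, hspan⟩ := exists_sl2Triple_coroot b j
  have h0 : ⁅(1 : A) ⊗ₜ[ℂ] f', wgen b A (fundWeight b i)⁆ = 0 := by
    have := pow_lie_wgen (A := A) (lam := fundWeight b i) hf' (n := 0)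
      (by rw [fundWeight_coroot, if_neg h, Nat.cast_zero])
    simpa using this
  have h1 : ⁅c ⊗ₜ[ℂ] (LieAlgebra.IsKilling.coroot j.1.1 : g), wgen b A (fundWeight b i)⁆ = 0 := by
    have := lie_lie_current c 1 e f' (wgen b A (fundWeight b i))
    rw [h0, nPlus_lie_wgen c he, lie_zero, lie_zero, add_zero, ht.lie_e_f, mul_one] at this
    exact this.symm
  refine ⟨h1, ?_⟩
  have h2 := lie_lie_current c 1 (LieAlgebra.IsKilling.coroot j.1.1 : g) f'
    (wgen b A (fundWeight b i))
  rw [h0, h1, lie_zero, lie_zero, add_zero, ht.lie_lie_smul_f ℂ, mul_one, TensorProduct.tmul_neg,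
    neg_lie, TensorProduct.tmul_smul, smul_lie, eq_comm, neg_eq_zero, smul_eq_zero] at h2
  obtain ⟨d, rfl⟩ := hspan f hf
  rw [TensorProduct.tmul_smul, smul_lie, h2.resolve_left two_ne_zero, smul_zero]

/-- As `ω_i(h_i) = 1`, the square of `f_i ⊗ 1` kills the generator. Applying `e_i ⊗ c` to this
relation gives the first identity, and applying `e_i ⊗ a` to the first gives the second. -/
theorem lie_wgen_fundWeight {f : g} (hf : f ∈ LieAlgebra.rootSpace H (-(i.1.1 : H → ℂ)))
    (a c : A) :
    ⁅c ⊗ₜ[ℂ] f, wgen b A (fundWeight b i)⁆ = ⁅(1 : A) ⊗ₜ[ℂ] f,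
      ⁅c ⊗ₜ[ℂ] (LieAlgebra.IsKilling.coroot i.1.1 : g), wgen b A (fundWeight b i)⁆⁆ ∧
    ⁅(a * c) ⊗ₜ[ℂ] (LieAlgebra.IsKilling.coroot i.1.1 : g), wgen b A (fundWeight b i)⁆ =
      ⁅a ⊗ₜ[ℂ] (LieAlgebra.IsKilling.coroot i.1.1 : g),
        ⁅c ⊗ₜ[ℂ] (LieAlgebra.IsKilling.coroot i.1.1 : g), wgen b A (fundWeight b i)⁆⁆ := by
  classical
  obtain ⟨e, he, f', hf', ht, hspan⟩ := exists_sl2Triple_coroot b i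
  set h : g := (LieAlgebra.IsKilling.coroot i.1.1 : g)
  set w := wgen b A (fundWeight b i)
  have h0 : ⁅(1 : A) ⊗ₜ[ℂ] f', ⁅(1 : A) ⊗ₜ[ℂ] f', w⁆⁆ = 0 := by
    have := pow_lie_wgen (A := A) (lam := fundWeight b i) hf' (n := 1)
      (by rw [fundWeight_coroot, if_pos rfl, Nat.cast_one])
    simpa [pow_two] using this
  have hew : ∀ c : A, ⁅c ⊗ₜ[ℂ] e, w⁆ = 0 := fun c => nPlus_lie_wgen c he
  have hhf : ∀ (c : A) (m : GlobalWeyl b A (fundWeight b i)), ⁅c ⊗ₜ[ℂ] ⁅h, f'⁆, m⁆ =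
      -((2 : ℂ) • ⁅c ⊗ₜ[ℂ] f', m⁆) := fun c m => by
    rw [ht.lie_lie_smul_f ℂ, TensorProduct.tmul_neg, neg_lie, TensorProduct.tmul_smul, smul_lie]
  have h1 : ∀ c : A, ⁅c ⊗ₜ[ℂ] f', w⁆ = ⁅(1 : A) ⊗ₜ[ℂ] f', ⁅c ⊗ₜ[ℂ] h, w⁆⁆ := by
    intro c
    have h2 := lie_lie_current c 1 e f' ⁅(1 : A) ⊗ₜ[ℂ] f', w⁆
    rw [h0, lie_zero, lie_lie_current c 1 e f' w, hew, lie_zero, add_zero, ht.lie_e_f, mul_one,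
      lie_lie_current, hhf, mul_one] at h2
    have h3 : (2 : ℂ) • (⁅(1 : A) ⊗ₜ[ℂ] f', ⁅c ⊗ₜ[ℂ] h, w⁆⁆ - ⁅c ⊗ₜ[ℂ] f', w⁆) = 0 := by
      rw [h2]; module
    exact (sub_eq_zero.1 ((smul_eq_zero.1 h3).resolve_left two_ne_zero)).symm
  constructor
  · obtain ⟨d, rfl⟩ := hspan f hf
    simp only [TensorProduct.tmul_smul, smul_lie, h1 c]
  · have h2 := lie_lie_current a c e f' w
    rw [hew, lie_zero, add_zero, ht.lie_e_f] at h2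
    have h3 := lie_lie_current a 1 e f' ⁅c ⊗ₜ[ℂ] h, w⁆
    have h4 := lie_lie_current a c e h w
    have h5 : ⁅e, h⁆ = -((2 : ℂ) • e) := by rw [← lie_skew, ht.lie_h_e_smul ℂ]
    rw [hew, lie_zero, add_zero, h5, TensorProduct.tmul_neg, neg_lie, TensorProduct.tmul_smul,
      smul_lie, hew, smul_zero, neg_zero] at h4
    rw [h4, lie_zero, add_zero, ht.lie_e_f, mul_one, ← h1, h2] at h3
    exact h3

/-- The action of `a` on `W_A(ω_i)` by right multiplication with `h_i ⊗ a`. -/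
def fundAct (a : A) : Module.End ℂ (GlobalWeyl b A (fundWeight b i)) :=
  rightActHom b (fundWeight b i) (cur a (LieAlgebra.IsKilling.coroot i.1.1))

theorem fundAct_lie (a : A) (x : A ⊗[ℂ] g) (m : GlobalWeyl b A (fundWeight b i)) :
    fundAct i a ⁅x, m⁆ = ⁅x, fundAct i a m⁆ :=
  rightActHom_lie _ x m

theorem fundAct_wgen (a : A) : fundAct i a (wgen b A (fundWeight b i)) =
    ⁅a ⊗ₜ[ℂ] (LieAlgebra.IsKilling.coroot i.1.1 : g), wgen b A (fundWeight b i)⁆ :=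
  rightActHom_wgen a _

theorem fundAct_one : fundAct (A := A) i 1 = 1 := by
  classical
  refine end_ext_weyl (fundAct_lie i 1) (fun _ _ => rfl) ?_
  rw [fundAct_wgen, cartan_lie_wgen, fundWeight_coroot, if_pos rfl, one_smul, Module.End.one_apply]

theorem fundAct_mul (a c : A) : fundAct i (a * c) = fundAct i a * fundAct i c := by
  refine end_ext_weyl (fundAct_lie i _) (fun x m => ?_) ?_
  · simp only [Module.End.mul_apply, fundAct_lie]
  · rw [Module.End.mul_apply, fundAct_wgen, fundAct_wgen, fundAct_lie, fundAct_wgen, mul_comm,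
      (lie_wgen_fundWeight i (zero_mem _) c a).2]

theorem fundAct_add (a c : A) : fundAct i (a + c) = fundAct i a + fundAct i c := by
  rw [fundAct, fundAct, fundAct, ← map_add]
  simp only [cur, TensorProduct.add_tmul, map_add]

theorem fundAct_smul (r : ℂ) (a : A) : fundAct i (r • a) = r • fundAct i a := by
  rw [fundAct, fundAct, ← map_smul]
  simp only [cur, ← TensorProduct.smul_tmul', map_smul]

theorem cartan_lie_wgen_fundWeight (c : A) (h : H) :
    ⁅c ⊗ₜ[ℂ] (h : g), wgen b A (fundWeight b i)⁆ =
      fundWeight b i h • fundAct i c (wgen b A (fundWeight b i)) := by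
  classical
  conv_lhs => rw [← sum_fundWeight_smul_coroot b h]
  rw [AddSubmonoidClass.coe_finsetSum, TensorProduct.tmul_sum, sum_lie,
    Finset.sum_eq_single i]
  · rw [fundAct_wgen, SetLike.val_smul, TensorProduct.tmul_smul, smul_lie]
  · intro j _ hj
    rw [SetLike.val_smul, TensorProduct.tmul_smul, smul_lie,
      (lie_wgen_fundWeight_of_ne i hj (zero_mem _) c).1, smul_zero]
  · intro hi; exact absurd (Finset.mem_univ i) hi

/-- On `W_A(ω_i)` the action of `𝔤 ⊗ A` factors through a nilpotent thickening of the diagonal of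
`A ⊗ A`. -/
theorem exists_shiftOp_pow_eq_zero (a : A) : ∃ n, ∀ (x : g) (m : GlobalWeyl b A (fundWeight b i)),
    (shiftOp a (fundAct i a) ^ n) (fun c : A => ⁅c ⊗ₜ[ℂ] x, m⁆) = 0 := by
  classical
  set w := wgen b A (fundWeight b i) with hw
  have hlift : ∀ {p q : ℕ} {F : A → GlobalWeyl b A (fundWeight b i)}, p ≤ q →
      (shiftOp a (fundAct i a) ^ p) F = 0 → (shiftOp a (fundAct i a) ^ q) F = 0 :=
    fun hpq h => Module.End.pow_map_zero_of_le hpq h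
  have hadd : ∀ x y : g, (fun c : A => ⁅c ⊗ₜ[ℂ] (x + y), w⁆) =
      (fun c : A => ⁅c ⊗ₜ[ℂ] x, w⁆) + fun c : A => ⁅c ⊗ₜ[ℂ] y, w⁆ := fun x y => by
    funext c; simp [TensorProduct.tmul_add]
  have hsmul : ∀ (r : ℂ) (x : g), (fun c : A => ⁅c ⊗ₜ[ℂ] (r • x), w⁆) =
      r • fun c : A => ⁅c ⊗ₜ[ℂ] x, w⁆ := fun r x => by
    funext c; simp [TensorProduct.tmul_smul]
  -- On the generator, `𝔫^+` needs exponent `0`, while `𝔥` and the simple lowering vectors need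
  -- exponent `1`. Exponents add under brackets, so these `x` form a subalgebra, which is all of `𝔤`
  -- by generation.
  let Z : LieSubalgebra ℂ g :=
    { carrier := {x | ∃ n, (shiftOp a (fundAct i a) ^ n) (fun c : A => ⁅c ⊗ₜ[ℂ] x, w⁆) = 0}
      add_mem' := by
        rintro x y ⟨p, hp⟩ ⟨q, hq⟩
        exact ⟨p + q, by rw [hadd, map_add, hlift (Nat.le_add_right p q) hp,
          hlift (Nat.le_add_left q p) hq, add_zero]⟩
      zero_mem' := ⟨0, by funext c; simp⟩
      smul_mem' := by
        rintro r x ⟨p, hp⟩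
        exact ⟨p, by rw [hsmul, map_smul, hp, smul_zero]⟩
      lie_mem' := by
        rintro x y ⟨p, hp⟩ ⟨q, hq⟩
        exact ⟨p + q, shiftOp_pow_lie (fundAct_lie i a) a hp hq⟩ }
  have hZ : ∀ x : g, x ∈ Z := by
    refine eq_top_of_nPlus_le b (fun x hx => ⟨0, ?_⟩) (fun h hh => ⟨1, ?_⟩)
      (fun j y hy => ⟨1, ?_⟩)
    · funext c
      exact nPlus_lie_wgen c hx
    · funext c
      rw [pow_one, shiftOp_apply]
      have := fun c : A => cartan_lie_wgen_fundWeight i c ⟨h, hh⟩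
      simp only [← hw] at this
      rw [this, this, map_smul, fundAct_mul, Module.End.mul_apply, sub_self, Pi.zero_apply]
    · funext c
      rw [pow_one, shiftOp_apply]
      by_cases hj : j = i
      · subst hj
        have h1 : ∀ c : A, ⁅c ⊗ₜ[ℂ] y, w⁆ = ⁅(1 : A) ⊗ₜ[ℂ] y, fundAct j c w⁆ := fun c => by
          rw [hw, fundAct_wgen]
          exact (lie_wgen_fundWeight j hy c c).1
        rw [h1, h1, fundAct_lie, fundAct_mul, Module.End.mul_apply, sub_self, Pi.zero_apply]
      · rw [(lie_wgen_fundWeight_of_ne i hj hy _).2, (lie_wgen_fundWeight_of_ne i hj hy _).2,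
          map_zero, sub_self, Pi.zero_apply]
  -- A finite basis of `𝔤` makes the exponent uniform in `x`, which the induction over `m` below
  -- requires.
  obtain ⟨n, hn⟩ : ∃ n, ∀ x : g,
      (shiftOp a (fundAct i a) ^ n) (fun c : A => ⁅c ⊗ₜ[ℂ] x, w⁆) = 0 := by
    let B := Module.finBasis ℂ g
    choose p hp using fun k => hZ (B k)
    refine ⟨∑ k, p k, fun x => ?_⟩
    have : (fun c : A => ⁅c ⊗ₜ[ℂ] x, w⁆) = ∑ k, B.repr x k • fun c : A => ⁅c ⊗ₜ[ℂ] B k, w⁆ := by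
      funext c
      conv_lhs => rw [← B.sum_repr x]
      simp only [TensorProduct.tmul_sum, TensorProduct.tmul_smul, sum_lie, smul_lie,
        Finset.sum_apply, Pi.smul_apply]
    rw [this, map_sum]
    refine Finset.sum_eq_zero fun k _ => ?_
    rw [map_smul, hlift (Finset.single_le_sum (fun _ _ => Nat.zero_le _) (Finset.mem_univ k)) (hp k),
      smul_zero]
  refine ⟨n, fun x m => ?_⟩
  induction m using weyl_induction generalizing x with
  | hw => exact hn x
  | hadd m m' hm hm' =>
    have : (fun c : A => ⁅c ⊗ₜ[ℂ] x, m + m'⁆) =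
        (fun c : A => ⁅c ⊗ₜ[ℂ] x, m⁆) + fun c : A => ⁅c ⊗ₜ[ℂ] x, m'⁆ := by
      funext c; simp
    rw [this, map_add, hm, hm', add_zero]
  | hsmul r m hm =>
    have : (fun c : A => ⁅c ⊗ₜ[ℂ] x, r • m⁆) = r • fun c : A => ⁅c ⊗ₜ[ℂ] x, m⁆ := by
      funext c; simp
    rw [this, map_smul, hm, smul_zero]
  | hlie d y m hm => exact shiftOp_pow_lie_apply (fundAct_lie i a) a hm d x y

theorem weylMap_fundAct (σ : A →ₐ[ℂ] A) (a : A) (m : GlobalWeyl b A (fundWeight b i)) :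
    fundAct i (σ a) (weylMap b (fundWeight b i) σ m) =
      weylMap b (fundWeight b i) σ (fundAct i a m) :=
  (weylMap_rightActHom σ a _ m).symm

theorem eq_zero_of_weylMap_eigenvectors {a : A} {σ σ' : A →ₐ[ℂ] A} (hσ : ∀ c, σ' (σ c) = c)
    (hfin : ∀ c, IsLocallyFinite σ.toLinearMap c) {z : ℕ → ℂ} (hz : Function.Injective z)
    {m : GlobalWeyl b A (fundWeight b i)} (h : fundAct i a m = z 0 • m)
    (hstep : ∀ n u, fundAct i a u = z n • u → fundAct i a (weylMap b (fundWeight b i) σ u) =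
      z (n + 1) • weylMap b (fundWeight b i) σ u) : m = 0 := by
  obtain ⟨N, hN, hm, hτ⟩ := isLocallyFinite_weylMap hfin m
  have : Module.Finite ℂ N := Module.Finite.iff_fg.2 hN
  have hinj : Function.Injective (weylMap b (fundWeight b i) σ) :=
    Function.LeftInverse.injective (g := weylMap b (fundWeight b i) σ') (weylMap_comp_eq_id hσ)
  refine eq_zero_of_eigenvectors (T := fundAct i a) hinj hτ hm hz fun n => ?_
  induction n with
  | zero => exact h
  | succ n ih => rw [pow_succ', Module.End.mul_apply]; exact hstep n _ ih

/-- Since `σ a = a + 1`, the induced automorphism lowers an eigenvalue of `fundAct i a` by `1`, so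
the eigenvalues never repeat. -/
theorem eq_zero_of_fundAct_of_translate {a : A} {σ σ' : A →ₐ[ℂ] A} (hσ : ∀ c, σ' (σ c) = c)
    (hfin : ∀ c, IsLocallyFinite σ.toLinearMap c) (ha : σ a = a + 1) (z : ℂ)
    (m : GlobalWeyl b A (fundWeight b i)) (h : fundAct i a m = z • m) : m = 0 := by
  refine eq_zero_of_weylMap_eigenvectors i hσ hfin (z := fun n : ℕ => z - n)
    (fun p q hpq => by simpa using hpq) (by simpa using h) fun n u hu => ?_
  have h1 := weylMap_fundAct i σ a u
  rw [hu, map_smul, ha, fundAct_add, fundAct_one, LinearMap.add_apply, Module.End.one_apply,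
    ← eq_sub_iff_add_eq] at h1
  rw [h1]
  push_cast
  module

/-- Here the automorphism halves an eigenvalue. The halves stay distinct because `z ≠ 0`, the
eigenvalue `0` being excluded by invertibility of `a`. -/
theorem eq_zero_of_fundAct_of_scale {a a' : A} (haa' : a' * a = 1) {σ σ' : A →ₐ[ℂ] A}
    (hσ : ∀ c, σ' (σ c) = c) (hfin : ∀ c, IsLocallyFinite σ.toLinearMap c)
    (ha : σ a = (2 : ℂ) • a) (z : ℂ) (m : GlobalWeyl b A (fundWeight b i))
    (h : fundAct i a m = z • m) : m = 0 := by
  by_cases hz : z = 0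
  · have := LinearMap.congr_fun (fundAct_mul i a' a) m
    rwa [haa', fundAct_one, Module.End.mul_apply, h, hz, zero_smul, map_zero] at this
  refine eq_zero_of_weylMap_eigenvectors i hσ hfin (z := fun n : ℕ => z * 2⁻¹ ^ n)
    (fun p q hpq => ?_) (by simpa using h) fun n u hu => ?_
  · have := mul_left_cancel₀ hz hpq
    have h2 : ((2⁻¹ : ℝ) ^ p : ℝ) = (2⁻¹ : ℝ) ^ q := by
      apply Complex.ofReal_injective
      push_cast
      exact this
    exact pow_right_injective₀ (by norm_num) (by norm_num) h2
  · have h1 := weylMap_fundAct i σ a u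
    rw [hu, map_smul, ha, fundAct_smul, LinearMap.smul_apply] at h1
    have h2 := congrArg ((2⁻¹ : ℂ) • ·) h1
    simp only [smul_smul, inv_mul_cancel₀ (two_ne_zero' ℂ), one_smul] at h2
    rw [h2, pow_succ]
    congr 1
    ring

end FundamentalWeyl

end WeylHom

end

noncomputable section

namespace WeylHom

/-! ### Local nilpotence on tensor products. -/

section LieTensor

variable {L ι : Type*} [LieRing L] [LieAlgebra ℂ L] [Fintype ι]
  {M : ι → Type*} [∀ i, AddCommGroup (M i)] [∀ i, Module ℂ (M i)]
  [∀ i, LieRingModule L (M i)] [∀ i, LieModule ℂ L (M i)]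

theorem tensorAct_eq_sum_slotMap (x : L) :
    (tensorAct x : Module.End ℂ (⨂[ℂ] i, M i)) =
      ∑ j, slotMap j (LieModule.toEnd ℂ L (M j) x) := rfl

theorem lie_eq_sum_slotMap (x : L) (v : ⨂[ℂ] i, M i) :
    ⁅x, v⁆ = ∑ j, slotMap j (LieModule.toEnd ℂ L (M j) x) v := by
  rw [lie_def, tensorAct_eq_sum_slotMap, LinearMap.sum_apply]

theorem exists_pow_eq_zero_tensor {x : L}
    (h : ∀ i (m : M i), ∃ p, (LieModule.toEnd ℂ L (M i) x ^ p) m = 0) (v : ⨂[ℂ] i, M i) :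
    ∃ p, (LieModule.toEnd ℂ L (⨂[ℂ] i, M i) x ^ p) v = 0 := by
  classical
  induction v using PiTensorProduct.induction_on with
  | add v w hv hw =>
    obtain ⟨p, hp⟩ := hv
    obtain ⟨q, hq⟩ := hw
    exact ⟨p + q, by rw [map_add, Module.End.pow_map_zero_of_le (Nat.le_add_right p q) hp,
      Module.End.pow_map_zero_of_le (Nat.le_add_left q p) hq, add_zero]⟩
  | smul_tprod r m =>
    obtain ⟨p, hp⟩ := sum_pow_apply_eq_zero
      (fun j => slotMap j (LieModule.toEnd ℂ L (M j) x)) (s := Finset.univ)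
      (v := PiTensorProduct.tprod ℂ m) (fun i _ j _ => by
        by_cases h : i = j
        · subst h; exact Commute.refl _
        · exact slotMap_commute h _ _) (fun j _ => by
        obtain ⟨p, hp⟩ := h j (m j)
        exact ⟨p, by rw [← map_pow, slotMap_tprod, hp, MultilinearMap.map_update_zero]⟩)
    exact ⟨p, by rw [map_smul]; exact (congrArg (r • ·) hp).trans (smul_zero r)⟩

end LieTensor

/-! ### Separating the slots of an invariant tensor. -/

section SlotShift

variable {K ι A : Type*} [Field K] [CommRing A] {M : ι → Type*} [∀ i, AddCommGroup (M i)]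
  [∀ i, Module K (M i)]

/-- On a pure tensor, inserting a vector into slot `j` intertwines `T` with `slotMap j T`, so the
relation carries over from the factor. -/
theorem shiftOp_pow_slotMap_eq_zero {a : A} {j : ι} {T : Module.End K (M j)}
    {Φ : A → Module.End K (M j)} {n : ℕ}
    (h : ∀ m, (shiftOp a T ^ n) (fun c : A => Φ c m) = 0) (v : ⨂[K] i, M i) :
    (shiftOp a (slotMap j T) ^ n) (fun c : A => slotMap j (Φ c) v) = 0 := by
  classical
  induction v using PiTensorProduct.induction_on with
  | add v w hv hw =>
    simp only [map_add]
    exact (map_add (shiftOp a (slotMap j T) ^ n) _ _).trans (by rw [hv, hw, add_zero])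
  | smul_tprod r m =>
    simp only [map_smul]
    refine (map_smul (shiftOp a (slotMap j T) ^ n) r _).trans ?_
    have := shiftOp_pow_comp a (T := T) (T' := slotMap j T)
      (G := (PiTensorProduct.tprod K).toLinearMap m j) (fun u => by
        simp only [MultilinearMap.toLinearMap_apply, slotMap_tprod, Function.update_self,
          Function.update_idem]) n (fun c : A => Φ c (m j)) 1
    rw [h] at this
    simp only [mul_one, Pi.zero_apply, map_zero, MultilinearMap.toLinearMap_apply] at this
    simp only [slotMap_tprod]
    rw [this]
    exact smul_zero r

variable [Fintype ι]

theorem slotMap_eq_zero_of_sum_eq_zero [IsAlgClosed K] {a : A} {T : ∀ j, Module.End K (M j)}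
    (hT : ∀ j (z : K) (m : M j), T j m = z • m → m = 0) {Φ : ∀ j, A → Module.End K (M j)}
    (h : ∀ j, ∃ n, ∀ m, (shiftOp a (T j) ^ n) (fun c : A => Φ j c m) = 0) {v : ⨂[K] i, M i}
    (hv : ∀ c, ∑ j, slotMap j (Φ j c) v = 0) (j : ι) (c : A) : slotMap j (Φ j c) v = 0 := by
  choose n hn using h
  -- On functions of `c`, `L` multiplies the argument by `a` and `R j` applies `T j` in slot `j` to
  -- the value. Injectivity of `R i - R j` is where the absence of eigenvectors enters.
  have := eq_zero_of_sum_eq_zero (L := LinearMap.funLeft K (⨂[K] i, M i) (a * ·))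
    (R := fun j => (slotMap j (T j)).compLeft A)
    (x := fun j (c : A) => slotMap j (Φ j c) v)
    (fun _ => rfl) (fun i j => by
      by_cases h : i = j
      · subst h; exact Commute.refl _
      · ext f c
        exact LinearMap.congr_fun (slotMap_commute h _ _).eq (f c))
    (fun i j h f hf => by
      funext c
      exact eq_zero_of_slotMap_eq h _ _ (hT j) (congrFun hf c))
    (fun j => shiftOp_pow_slotMap_eq_zero (hn j) v) (by
      funext c
      rw [Finset.sum_apply]
      exact hv c) j
  exact congrFun this c

omit [Fintype ι] in
theorem slotMap_mapIncl_eq_zero (N : ∀ i, Submodule K (M i)) {j : ι} {S : Module.End K (M j)}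
    (hS : ∀ m ∈ N j, S m = 0) (t : ⨂[K] i, N i) :
    slotMap j S (PiTensorProduct.mapIncl N t) = 0 := by
  classical
  induction t using PiTensorProduct.induction_on with
  | add v w hv hw => rw [map_add, map_add, hv, hw, add_zero]
  | smul_tprod r m =>
    rw [map_smul, map_smul, PiTensorProduct.mapIncl, PiTensorProduct.map_tprod, slotMap_tprod,
      Submodule.subtype_apply, hS _ (m j).2, MultilinearMap.map_update_zero, smul_zero]

end SlotShift

variable {g : Type*} [LieRing g] [LieAlgebra ℂ g] [FiniteDimensional ℂ g]
  [LieAlgebra.IsSimple ℂ g] {H : LieSubalgebra ℂ g} [H.IsCartanSubalgebra]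

variable {b : (LieAlgebra.IsKilling.rootSystem H).Base}

variable {A : Type*} [CommRing A] [Algebra ℂ A]

/-! ### Integrability and the power relations. -/

section Integrability

variable {M : Type*} [AddCommGroup M] [Module ℂ M] [LieRingModule (A ⊗[ℂ] g) M]
  [LieModule ℂ (A ⊗[ℂ] g) M]

theorem mem_maxGenEigenspace_zero_of_mem_rootSpace {i : b.support} {y : g}
    (hy : y ∈ LieAlgebra.rootSpace H (-(i.1.1 : H → ℂ))) (x : A ⊗[ℂ] g) :
    x ∈ (LieModule.toEnd ℂ (A ⊗[ℂ] g) (A ⊗[ℂ] g) ((1 : A) ⊗ₜ[ℂ] y)).maxGenEigenspace 0 := by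
  induction x using TensorProduct.induction_on with
  | zero => exact zero_mem _
  | add x x' hx hx' => exact add_mem hx hx'
  | tmul c x =>
    have hχ : (-(i.1.1 : H → ℂ)) ≠ 0 :=
      neg_ne_zero.2 (LieSubalgebra.isNonZero_coe_root i.1)
    obtain ⟨n, hn⟩ := LieAlgebra.isNilpotent_ad_of_mem_rootSpace H hχ hy
    have key : ∀ k, (LieModule.toEnd ℂ (A ⊗[ℂ] g) (A ⊗[ℂ] g) ((1 : A) ⊗ₜ[ℂ] y) ^ k) (c ⊗ₜ x) =
        c ⊗ₜ[ℂ] (LieAlgebra.ad ℂ g y ^ k) x := by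
      intro k
      induction k with
      | zero => rfl
      | succ k ih =>
        rw [pow_succ', Module.End.mul_apply, ih, LieModule.toEnd_apply_apply, current_lie, one_mul,
          pow_succ', Module.End.mul_apply, LieAlgebra.ad_apply]
    rw [Module.End.mem_maxGenEigenspace]
    refine ⟨n, ?_⟩
    rw [zero_smul, sub_zero, key, hn, LinearMap.zero_apply, TensorProduct.tmul_zero]

/-- Because `y ⊗ 1` acts locally nilpotently on `𝔤 ⊗ A` by the adjoint action, the vectors killed by
some power of it form a submodule; it contains the generator. -/
theorem exists_pow_eq_zero_globalWeyl {lam : Module.Dual ℂ H} {i : b.support} {y : g}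
    (hy : y ∈ LieAlgebra.rootSpace H (-(i.1.1 : H → ℂ))) {n : ℕ}
    (hn : lam (LieAlgebra.IsKilling.coroot i.1.1) = n) (m : GlobalWeyl b A lam) :
    ∃ p, (LieModule.toEnd ℂ (A ⊗[ℂ] g) _ ((1 : A) ⊗ₜ[ℂ] y) ^ p) m = 0 := by
  suffices m ∈ (LieModule.toEnd ℂ (A ⊗[ℂ] g) (GlobalWeyl b A lam)
      ((1 : A) ⊗ₜ[ℂ] y)).maxGenEigenspace 0 by
    rw [Module.End.mem_maxGenEigenspace] at this
    simpa only [zero_smul, sub_zero] using this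
  induction m using weyl_induction with
  | hw =>
    rw [Module.End.mem_maxGenEigenspace]
    exact ⟨n + 1, by rw [zero_smul, sub_zero]; exact pow_lie_wgen hy hn⟩
  | hadd m m' hm hm' => exact add_mem hm hm'
  | hsmul c m hm => exact Submodule.smul_mem _ c hm
  | hlie c x m hm =>
    have := LieModule.lie_mem_maxGenEigenspace_toEnd
      (mem_maxGenEigenspace_zero_of_mem_rootSpace hy (c ⊗ₜ[ℂ] x)) hm
    rwa [add_zero] at this

theorem exists_pow_eq_zero_weylTensor (s : b.support → ℕ) {i : b.support} {y : g}
    (hy : y ∈ LieAlgebra.rootSpace H (-(i.1.1 : H → ℂ))) (v : WeylTensor b A s) :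
    ∃ p, (LieModule.toEnd ℂ (A ⊗[ℂ] g) _ ((1 : A) ⊗ₜ[ℂ] y) ^ p) v = 0 := by
  classical
  exact exists_pow_eq_zero_tensor (fun j m => exists_pow_eq_zero_globalWeyl hy
    (n := if i = j.1 then 1 else 0) (by rw [fundWeight_coroot]; split_ifs <;> simp) m) v

/-- A highest weight vector on which the lowering operator `y` of a simple root acts nilpotently
satisfies the corresponding relation of the Weyl module. -/
theorem pow_succ_eq_zero_of_invariant {mu : Module.Dual ℂ H} {v : M} (hv : v ∈ invariants b A M)
    (hmu : v ∈ weightSpace A M mu) {i : b.support} {y : g}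
    (hy : y ∈ LieAlgebra.rootSpace H (-(i.1.1 : H → ℂ))) {n : ℕ}
    (hn : mu (LieAlgebra.IsKilling.coroot i.1.1) = n)
    (hnil : ∀ f ∈ LieAlgebra.rootSpace H (-(i.1.1 : H → ℂ)),
      ∃ p, (LieModule.toEnd ℂ (A ⊗[ℂ] g) M ((1 : A) ⊗ₜ[ℂ] f) ^ p) v = 0) :
    (LieModule.toEnd ℂ (A ⊗[ℂ] g) M ((1 : A) ⊗ₜ[ℂ] y) ^ (n + 1)) v = 0 := by
  by_cases hv0 : v = 0
  · rw [hv0, map_zero]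
  obtain ⟨e, he, f, hf, ht, hspan⟩ := exists_sl2Triple_coroot b i
  obtain ⟨c, rfl⟩ := hspan y hy
  rw [TensorProduct.tmul_smul, map_smul, smul_pow, LinearMap.smul_apply]
  suffices (LieModule.toEnd ℂ (A ⊗[ℂ] g) M ((1 : A) ⊗ₜ[ℂ] f) ^ (n + 1)) v = 0 by
    rw [this, smul_zero]
  -- An `sl₂`-triple requires `h ≠ 0`. If `1 ⊗ h` vanishes, then so does `1 ⊗ f`, by `[h, f] = -2
  -- f`.
  by_cases h0 : (1 : A) ⊗ₜ[ℂ] (LieAlgebra.IsKilling.coroot i.1.1 : g) = 0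
  · have h1 := current_lie (1 : A) 1 (LieAlgebra.IsKilling.coroot i.1.1 : g) f
    rw [h0, zero_lie, ht.lie_lie_smul_f ℂ, TensorProduct.tmul_neg, TensorProduct.tmul_smul,
      eq_comm, neg_eq_zero, smul_eq_zero, mul_one] at h1
    rw [h1.resolve_left two_ne_zero, map_zero, zero_pow (Nat.succ_ne_zero n), LinearMap.zero_apply]
  have t : IsSl2Triple ((1 : A) ⊗ₜ[ℂ] (LieAlgebra.IsKilling.coroot i.1.1 : g)) (1 ⊗ₜ[ℂ] e)
      (1 ⊗ₜ[ℂ] f) :=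
    { h_ne_zero := h0
      lie_e_f := by rw [current_lie, one_mul, ht.lie_e_f]
      lie_h_e_nsmul := by rw [current_lie, one_mul, ht.lie_h_e_nsmul, TensorProduct.tmul_smul]
      lie_h_f_nsmul := by
        rw [current_lie, one_mul, ht.lie_h_f_nsmul, TensorProduct.tmul_neg,
          TensorProduct.tmul_smul] }
  have P : t.HasPrimitiveVectorWith v (n : ℂ) :=
    { ne_zero := hv0
      lie_h := by rw [hmu, hn]
      lie_e := hv 1 e he }
  -- At the last nonzero `f ^ q v`, the identity `e f ^ (q + 1) v = (q + 1)(n - q) f ^ q v` has zero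
  -- left side, so `q = n`.
  obtain ⟨q, hq, hq'⟩ := Nat.exists_not_and_succ_of_not_zero_of_exists
    (p := fun q => (LieModule.toEnd ℂ (A ⊗[ℂ] g) M ((1 : A) ⊗ₜ[ℂ] f) ^ q) v = 0) hv0 (hnil f hf)
  have := P.lie_e_pow_succ_toEnd_f q
  rw [hq', lie_zero, eq_comm, smul_eq_zero_iff_left hq, mul_eq_zero, sub_eq_zero] at this
  have hqn : n = q := by
    exact_mod_cast this.resolve_left (Nat.cast_add_one_ne_zero q)
  rw [hqn]; exact hq'

end Integrability

/-! ### Homomorphisms out of a global Weyl module. -/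

section WeylHom

attribute [local instance 100] LieRing.ofAssociativeRing

variable {M : Type*} [AddCommGroup M] [Module ℂ M] [LieRingModule (A ⊗[ℂ] g) M]
  [LieModule ℂ (A ⊗[ℂ] g) M] {lam : Module.Dual ℂ H}

/-- The universal property of the global Weyl module. -/
theorem exists_weylHom {v : M} (hv : v ∈ invariants b A M) (hlam : v ∈ weightSpace A M lam)
    (hpow : ∀ i : b.support, ∀ y ∈ LieAlgebra.rootSpace H (-(i.1.1 : H → ℂ)), ∀ n : ℕ,
      lam (LieAlgebra.IsKilling.coroot i.1.1) = n →
      (LieModule.toEnd ℂ (A ⊗[ℂ] g) M ((1 : A) ⊗ₜ[ℂ] y) ^ (n + 1)) v = 0) :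
    ∃ f : GlobalWeyl b A lam →ₗ⁅ℂ, A ⊗[ℂ] g⁆ M, f (wgen b A lam) = v := by
  let φ : UA A g →ₐ[ℂ] Module.End ℂ M :=
    UniversalEnvelopingAlgebra.lift ℂ (LieModule.toEnd ℂ (A ⊗[ℂ] g) M)
  have hφ : ∀ x, φ (UniversalEnvelopingAlgebra.ι ℂ x) = LieModule.toEnd ℂ (A ⊗[ℂ] g) M x :=
    fun x => UniversalEnvelopingAlgebra.lift_ι_apply ℂ _ x
  let inst : Module (UA A g) M := Module.compHom M φ.toRingHom
  have hsmul : ∀ (u : UA A g) (m : M), u • m = φ u m := fun _ _ => rfl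
  have hcur : ∀ (c : A) (x : g), φ (cur c x) = LieModule.toEnd ℂ (A ⊗[ℂ] g) M (c ⊗ₜ x) :=
    fun c x => hφ _
  let F : GlobalWeyl b A lam →ₗ[UA A g] M :=
    Submodule.liftQ (weylIdeal b A lam) (LinearMap.toSpanSingleton (UA A g) M v) (by
      refine Submodule.span_le.2 fun u hu => ?_
      change u • v = 0
      rw [hsmul]
      rcases hu with (⟨c, x, hx, rfl⟩ | ⟨h, rfl⟩) | ⟨i, y, hy, n, hn, rfl⟩
      · rw [hcur]; exact hv c x hx
      · rw [map_sub, hcur, AlgHom.commutes, LinearMap.sub_apply, Module.algebraMap_end_apply,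
          LieModule.toEnd_apply_apply, hlam h, sub_self]
      · rw [map_pow, hcur]; exact hpow i y hy n hn)
  have hF : F (wgen b A lam) = v := by
    change (1 : UA A g) • v = v
    rw [one_smul]
  refine ⟨{ toFun := F, map_add' := map_add F, map_smul' := fun c m => ?_, map_lie' := ?_ }, hF⟩
  · rw [RingHom.id_apply, ← algebraMap_smul (UA A g) c m, map_smul, hsmul, AlgHom.commutes,
      Module.algebraMap_end_apply]
  · intro x m
    change F (UniversalEnvelopingAlgebra.ι ℂ x • m) = ⁅x, F m⁆
    rw [map_smul, hsmul, hφ, LieModule.toEnd_apply_apply]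

omit [LieModule ℂ (A ⊗[ℂ] g) M] in
theorem weylHom_ext {f f' : GlobalWeyl b A lam →ₗ⁅ℂ, A ⊗[ℂ] g⁆ M}
    (h : f (wgen b A lam) = f' (wgen b A lam)) : f = f' := by
  ext m
  induction m using weyl_induction with
  | hw => exact h
  | hadd m m' hm hm' => rw [map_add, map_add, hm, hm']
  | hsmul c m hm => rw [map_smul, map_smul, hm]
  | hlie c x m hm => rw [LieModuleHom.map_lie, LieModuleHom.map_lie, hm]

/-- Evaluation at the generator identifies homomorphisms out of a global Weyl module with highest
weight vectors. -/
def homEquivInvariants (b : (LieAlgebra.IsKilling.rootSystem H).Base) (A : Type*) [CommRing A]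
    [Algebra ℂ A] (s : b.support → ℕ) (mu : Module.Dual ℂ H) :
    (GlobalWeyl b A mu →ₗ⁅ℂ, A ⊗[ℂ] g⁆ WeylTensor b A s) ≃ₗ[WeylTensorAlg b A s]
      invariantWeightSpace b A s mu :=
  LinearEquiv.ofBijective
    { toFun := fun f => ⟨f (wgen b A mu), ⟨
        fun c x hx => by rw [← LieModuleHom.map_lie, nPlus_lie_wgen c hx, map_zero],
        fun h => by rw [← LieModuleHom.map_lie, cartan_lie_wgen, map_smul]⟩⟩
      map_add' := fun f f' => rfl
      map_smul' := fun p f => rfl }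
    ⟨fun f f' h => weylHom_ext (congrArg Subtype.val h), fun v =>
      (exists_weylHom v.2.1 v.2.2 fun _ _ hy _ hn =>
        pow_succ_eq_zero_of_invariant v.2.1 v.2.2 hy hn fun _ hf =>
          exists_pow_eq_zero_weylTensor s hf _).imp fun _ hf => Subtype.ext hf⟩

end WeylHom

/-! ### Invariants of the tensor product. -/

section TensorInvariants

variable (s : b.support → ℕ)

/-- Slot separation upgrades invariance under the sum of the slot actions to invariance in each
slot, so every contraction of `v` is an invariant of its factor. -/
theorem mem_tensorInvariants_of_mem_invariants {a : A}
    (ha : ∀ (i : b.support) (z : ℂ) (m : GlobalWeyl b A (fundWeight b i)),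
      fundAct i a m = z • m → m = 0) {v : WeylTensor b A s}
    (hv : v ∈ invariants b A (WeylTensor b A s)) : v ∈ tensorInvariants b A s := by
  refine mem_range_mapIncl_of_contract _ fun j f c x hx => ?_
  have h := slotMap_eq_zero_of_sum_eq_zero (a := a)
    (M := fun j : Factors b s => GlobalWeyl b A (fundWeight b j.1))
    (T := fun j => fundAct j.1 a)
    (Φ := fun j c => LieModule.toEnd ℂ (A ⊗[ℂ] g) (GlobalWeyl b A (fundWeight b j.1)) (c ⊗ₜ x))
    (fun j => ha j.1)
    (fun j => (exists_shiftOp_pow_eq_zero j.1 a).imp fun _ hn => hn x)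
    (v := v) (fun c => (lie_eq_sum_slotMap (c ⊗ₜ[ℂ] x) v).symm.trans (hv c x hx)) j c
  have h' := contract_slotMap_self j f
    (LieModule.toEnd ℂ (A ⊗[ℂ] g) (GlobalWeyl b A (fundWeight b j.1)) (c ⊗ₜ x)) v
  rw [h, map_zero] at h'
  exact h'.symm

theorem tensorInvariants_le_invariants :
    tensorInvariants b A s ≤ invariants b A (WeylTensor b A s) := by
  rintro _ ⟨t, rfl⟩ c x hx
  rw [lie_eq_sum_slotMap]
  exact Finset.sum_eq_zero fun j _ => slotMap_mapIncl_eq_zero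
    (fun j : Factors b s => invariants b A (GlobalWeyl b A (fundWeight b j.1)))
    (fun _ hm => hm c x hx) t

/-- A variable of the ring serves as `a`: translation by `1` handles a polynomial variable, and
rescaling by `2`, which has infinite order, handles an invertible one. -/
theorem exists_fundAct_laurentPoly {k l : ℕ} (hkl : 0 < k + l) :
    ∃ a : LaurentPoly k l, ∀ (i : b.support) (z : ℂ)
      (m : GlobalWeyl b (LaurentPoly k l) (fundWeight b i)), fundAct i a m = z • m → m = 0 := by
  rcases Nat.eq_zero_or_pos k with hk | hk
  · let i₀ : Fin l := ⟨0, by omega⟩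
    refine ⟨polyVar i₀, fun i => eq_zero_of_fundAct_of_translate i (σ := translateHom i₀ 1)
      (σ' := translateHom i₀ (-1)) (fun c => ?_) (isLocallyFinite_translateHom i₀ 1) ?_⟩
    · simpa using translateHom_translateHom_neg i₀ (-1) c
    · rw [translateHom_polyVar, map_one]
  · let i₀ : Fin k := ⟨0, hk⟩
    let c : ℂˣ := Units.mk0 2 two_ne_zero
    refine ⟨AddMonoidAlgebra.single (Pi.single i₀ 1, 0) 1, fun i =>
      eq_zero_of_fundAct_of_scale i (a' := AddMonoidAlgebra.single (-Pi.single i₀ 1, 0) 1) ?_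
      (σ := scaleHom i₀ c) (σ' := scaleHom i₀ c⁻¹) (fun x => ?_) (isLocallyFinite_scaleHom i₀ c) ?_⟩
    · rw [AddMonoidAlgebra.single_mul_single]
      simp [AddMonoidAlgebra.one_def]
      rfl
    · simpa using scaleHom_scaleHom_inv i₀ c⁻¹ x
    · rw [scaleHom_single]
      simp [c]

end TensorInvariants

end WeylHom

end

theorem theorem1 {g : Type*} [LieRing g] [LieAlgebra ℂ g] [FiniteDimensional ℂ g]
    [LieAlgebra.IsSimple ℂ g] (H : LieSubalgebra ℂ g) [H.IsCartanSubalgebra]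
    (b : (LieAlgebra.IsKilling.rootSystem H).Base) (k l : ℕ) (s : b.support → ℕ)
    (mu : Module.Dual ℂ H) (hmu : mu ∈ WeylHom.dominantWeights b) :
    Nonempty
      ((WeylHom.GlobalWeyl b (WeylHom.LaurentPoly k l) mu
          →ₗ⁅ℂ, WeylHom.LaurentPoly k l ⊗[ℂ] g⁆ WeylHom.WeylTensor b (WeylHom.LaurentPoly k l) s)
        ≃ₗ[WeylHom.WeylTensorAlg b (WeylHom.LaurentPoly k l) s]
        WeylHom.invariantWeightSpace b (WeylHom.LaurentPoly k l) s mu) ∧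
    (0 < k + l →
      ∀ v : WeylHom.WeylTensor b (WeylHom.LaurentPoly k l) s,
        v ∈ WeylHom.invariantWeightSpace b (WeylHom.LaurentPoly k l) s mu ↔
          v ∈ WeylHom.tensorInvariants b (WeylHom.LaurentPoly k l) s ∧
          v ∈ WeylHom.weightSpace (WeylHom.LaurentPoly k l)
            (WeylHom.WeylTensor b (WeylHom.LaurentPoly k l) s) mu) := by
  refine ⟨⟨WeylHom.homEquivInvariants b _ s mu⟩, fun hkl v => ?_⟩
  obtain ⟨a, ha⟩ := WeylHom.exists_fundAct_laurentPoly (b := b) hkl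
  exact ⟨fun hv => ⟨WeylHom.mem_tensorInvariants_of_mem_invariants s ha hv.1, hv.2⟩,
    fun hv => ⟨WeylHom.tensorInvariants_le_invariants s hv.1, hv.2⟩⟩
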